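/- Let $\nu$ be a probability distribution on $\mathbb R^d$. For $\theta\in\mathbb R^d$, $\sigma>0$ let $P_{\theta,\sigma}$ be the law of $(Y,X)$ where $X\sim\nu$, $Y=X^\top\theta+\epsilon$, and $\epsilon\sim N(0,\sigma^2)$ is independent of $X$; let $p_{\theta,\sigma}(y,x)$ be its density with respect to (Lebesgue measure)$\,\otimes\,\nu$, i.e. the $N(x^\top\theta,\sigma^2)$ density at $y$. The data $(Y_i,X_i)_{i\le n}$ have law $\mathbb P=P_{\theta_0,\sigma_0}^{\otimes n}$. The prior is $\pi=\pi_\theta\otimes\pi_\sigma$, where $\pi_\theta$ is the probability measure on the ball $\{\theta\in\mathbb R^d:\|\theta\|_1\le C_1\}$ with Lebesgue density proportional to $\prod_{j=1}^d(\tau^2+\theta_j^2)^{-2}$, and under $\pi_\sigma$ the variance $\sigma^2$ has the inverse-gamma distribution $IG(a,b)$ (density $\frac{b^a}{\Gamma(a)}x^{-a-1}e^{-b/x}$ on $x>0$). For $\alpha\in(0,1)$ the fractional posterior is $$\Pi_{n,\alpha}(d\theta,d\sigma)\ \propto\ \Big(\prod_{i=1}^n p_{\theta,\sigma}(Y_i,X_i)\Big)^{\alpha}\,\pi(d\theta,d\sigma),$$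 and $D_\alpha(P,R)=\frac1{\alpha-1}\log\int\big(\frac{dP}{d\mu}\big)^{\alpha}\big(\frac{dR}{d\mu}\big)^{1-\alpha}d\mu$ (for any $\mu$ dominating $P$ and $R$) is the $\alpha$-Rényi divergence. **Theorem.** Let $\sigma_{\min},\sigma_{\max},a>0$ and $\kappa\in\mathbb R$. There is a constant $c>0$ depending only on $\sigma_{\min},\sigma_{\max},a,\kappa$ such that the following holds. Let $\alpha,\varepsilon,\eta\in(0,1)$, let $n<d$, and let $\nu$, $C_{\rm x}>0$, $C_1$, $b$, $\theta_0\in\mathbb R^d$, $\sigma_0>0$ satisfy, with $s^*=\|\theta_0\|_0$ (the number of nonzero coordinates) and $\tau=\frac1{C_{\rm x}\sqrt{nd}}$, - $\mathbb E\|X_1\|_2^2<C_{\rm x}^2$, - $(2\sigma_{\min})^{-1}<\sigma_0^2<(2\sigma_{\max})^{-1}$, - $1\le s^*<n$ and $\|\theta_0\|_1\le C_1-2d\tau$, - $n^{-\kappa}\le b\le\kappa$. Put $\varepsilon_n=c\,\dfrac{s^*}{n}\log\!\Big(\dfrac{C_{\rm x}C_1\sqrt{nd}}{s^*}\Big)$.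 Then $$\mathbb P\left[\int D_\alpha(P_{\theta,\sigma},P_{\theta_0,\sigma_0})\,\Pi_{n,\alpha}(d\theta,d\sigma)\le\frac{(\alpha+1)\varepsilon_n+\alpha\sqrt{\frac{\varepsilon_n}{n\eta}}+\frac{\log(1/\varepsilon)}{n}}{1-\alpha}\right]\ \ge\ 1-\varepsilon-\eta .$$ In particular ($\kappa=1$), for the choice $b=n^{-1/2}$ the constant $c$ depends only on $\sigma_{\min},\sigma_{\max},a$. -/

import Mathlib

open MeasureTheory ProbabilityTheory
open scoped ENNReal NNReal

noncomputable section

/-- The law `P_{θ,σ}` of one observation `(Y, X)` in the random-design Gaussian linear model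
`Y = Xᵀθ + ε`, where `X ∼ ν` and `ε ∼ N(0, σ²)` are independent. -/
def modelLaw {d : ℕ} (ν : Measure (Fin d → ℝ)) (θ : Fin d → ℝ) (σ : ℝ) :
    Measure (ℝ × (Fin d → ℝ)) :=
  (ν.prod (gaussianReal 0 (σ ^ 2).toNNReal)).map (fun p => (p.1 ⬝ᵥ θ + p.2, p.1))

/-- The density `p_{θ,σ}(y, x)` of `P_{θ,σ}` with respect to (Lebesgue measure) ⊗ (law of `X`);
see `modelLaw_eq_withDensity`. -/
def modelDensity {d : ℕ} (θ : Fin d → ℝ) (σ : ℝ) (z : ℝ × (Fin d → ℝ)) : ℝ≥0∞ :=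
  gaussianPDF (z.2 ⬝ᵥ θ) (σ ^ 2).toNNReal z.1

theorem measurable_modelDensity {d : ℕ} (θ : Fin d → ℝ) (σ : ℝ) :
    Measurable (modelDensity θ σ) := by
  have h : Measurable fun z : ℝ × (Fin d → ℝ) => z.2 ⬝ᵥ θ := by
    unfold dotProduct; fun_prop
  unfold modelDensity gaussianPDF
  exact (measurable_uncurry_gaussianPDFReal.comp
    (h.prodMk (measurable_const.prodMk measurable_fst))).ennreal_ofReal

theorem modelLaw_eq_withDensity {d : ℕ} (ν : Measure (Fin d → ℝ)) [SFinite ν]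
    (θ : Fin d → ℝ) (σ : ℝ) (hσ : 0 < σ) :
    modelLaw ν θ σ = (volume.prod ν).withDensity (modelDensity θ σ) := by
  have hv : (σ ^ 2).toNNReal ≠ 0 := by
    have : 0 < σ ^ 2 := by positivity
    simpa using this.ne'
  have hdot : Measurable fun x : Fin d → ℝ => x ⬝ᵥ θ := by
    unfold dotProduct; fun_prop
  have hm : Measurable fun p : (Fin d → ℝ) × ℝ => (p.1 ⬝ᵥ θ + p.2, p.1) :=
    ((hdot.comp measurable_fst).add measurable_snd).prodMk measurable_fst
  ext s hs
  rw [modelLaw, Measure.map_apply hm hs, withDensity_apply _ hs,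
    Measure.prod_apply (hm hs), ← lintegral_indicator hs,
    lintegral_prod_symm _ (((measurable_modelDensity θ σ).indicator hs).aemeasurable)]
  refine lintegral_congr fun x => ?_
  have h1 : (Prod.mk x ⁻¹' ((fun p : (Fin d → ℝ) × ℝ => (p.1 ⬝ᵥ θ + p.2, p.1)) ⁻¹' s))
      = (fun e => x ⬝ᵥ θ + e) ⁻¹' ((fun y => (y, x)) ⁻¹' s) := rfl
  have hs' : MeasurableSet ((fun y : ℝ => (y, x)) ⁻¹' s) := measurable_prodMk_right hs
  rw [h1, ← Measure.map_apply (measurable_const_add _) hs', gaussianReal_map_const_add, zero_add,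
    gaussianReal_of_var_ne_zero _ hv, withDensity_apply _ hs', ← lintegral_indicator hs']
  rfl

/-- The likelihood `L_n(θ, σ) = ∏ᵢ p_{θ,σ}(Yᵢ, Xᵢ)` of a sample. -/
def likelihood {n d : ℕ} (z : Fin n → ℝ × (Fin d → ℝ)) (θ : Fin d → ℝ) (σ : ℝ) : ℝ≥0∞ :=
  ∏ i, modelDensity θ σ (z i)

/-- The probability measure proportional to `μ` (meaningful when `0 < μ univ < ∞`). -/
def normalizeMeasure {Ω : Type*} [MeasurableSpace Ω] (μ : Measure Ω) : Measure Ω :=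
  (μ Set.univ)⁻¹ • μ

/-- The scaled Student prior truncated to the `ℓ¹` ball `B₁(C₁)`: the probability measure with
Lebesgue density proportional to `∏ⱼ (τ² + θⱼ²)⁻²` on `{θ | ‖θ‖₁ ≤ C₁}`. -/
def studentPrior (d : ℕ) (τ C₁ : ℝ) : Measure (Fin d → ℝ) :=
  normalizeMeasure ((volume.restrict {θ : Fin d → ℝ | ∑ j, |θ j| ≤ C₁}).withDensity
    (fun θ => ENNReal.ofReal (∏ j, ((τ ^ 2 + θ j ^ 2) ^ 2)⁻¹)))

/-- The inverse-gamma distribution `IG(a, b)` with shape `a` and scale `b`. -/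
def invGammaMeasure (a b : ℝ) : Measure ℝ :=
  (volume.restrict (Set.Ioi (0 : ℝ))).withDensity
    (fun x => ENNReal.ofReal (b ^ a / Real.Gamma a * x ^ (-a - 1) * Real.exp (-b / x)))

/-- The prior on `(θ, σ)`: `θ` and `σ` are independent, `θ` has the truncated scaled Student
prior, and `σ² ∼ IG(a, b)`, `σ > 0`. -/
def prior (d : ℕ) (τ C₁ a b : ℝ) : Measure ((Fin d → ℝ) × ℝ) :=
  (studentPrior d τ C₁).prod ((invGammaMeasure a b).map Real.sqrt)

/-- The fractional posterior `Π_{n,α}(dθ, dσ) ∝ L_n(θ, σ)^α π(dθ, dσ)`. -/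
def fractionalPosterior {n d : ℕ} (α : ℝ) (π : Measure ((Fin d → ℝ) × ℝ))
    (z : Fin n → ℝ × (Fin d → ℝ)) : Measure ((Fin d → ℝ) × ℝ) :=
  normalizeMeasure (π.withDensity (fun p => likelihood z p.1 p.2 ^ α))

/-- The `α`-Rényi divergence
`D_α(P, R) = (α - 1)⁻¹ log ∫ (dP/dμ)^α (dR/dμ)^(1-α) dμ`, with dominating measure `μ = P + R`
and values in the extended reals (it is `+∞` when `0 < α < 1` and the integral vanishes). -/
def renyiDiv {Ω : Type*} [MeasurableSpace Ω] (α : ℝ) (P R : Measure Ω) : EReal :=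
  (((α - 1)⁻¹ : ℝ) : EReal) *
    ENNReal.log (∫⁻ x, (P.rnDeriv (P + R) x) ^ α * (R.rnDeriv (P + R) x) ^ (1 - α) ∂(P + R))

/-- The sparsity `‖θ‖₀`: the number of nonzero coordinates. -/
def sparsity {d : ℕ} (θ : Fin d → ℝ) : ℕ := (Finset.univ.filter fun j => θ j ≠ 0).card

/-- The rate `ε_n = c s log(Cx C₁ √(nd) / s) / n`. -/
def rate (c Cx C₁ : ℝ) (n d s : ℕ) : ℝ :=
  c * s * Real.log (Cx * C₁ * √((n : ℝ) * d) / s) / n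

end

/-!
The design has only a second moment, so the variance of the log-likelihood ratio may be infinite and
the usual route to such bounds (Chebyshev's inequality for the averaged log-likelihood ratio) is not
available. The argument runs as follows.

Write `A(θ, σ) = ∫ p_{θ,σ}^α p_{θ₀,σ₀}^(1-α)`, so that `(1 - α) D_α = -log A`, and let `R(θ, σ)` be
the `α`-th power of the likelihood ratio. The `P₀ⁿ`-expectation of `R(θ, σ)` is `A(θ, σ)ⁿ`. Hence for
every `F ≥ 0` the random variable `∫ e^F R dπ` has expectation `∫ e^F Aⁿ dπ`; Markov's and Jensen's
inequalities bound the posterior mean of `F` by `log (∫ e^F Aⁿ dπ) + log (1/δ) - log ∫ R dπ` with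
probability at least `1 - δ` (`measure_exp_moment_gt_le`, `lintegral_fractionalPosterior_le`).

The evidence `∫ R dπ` is bounded below on the event that the design energy `∑ ‖Xᵢ‖²` is at most
`2 n Cx² / η`, which has probability at least `1 - η/2` (`exp_le_lintegral_fracRatio_prior`). Three
observations do this without any further moments. The prior near `θ₀` dominates a multiple of a
centred product Student law translated by `θ₀`, and only the nonzero coordinates of `θ₀` enter the
multiple. That law is symmetric, so the noise, which enters linearly, drops out by `cosh ≥ 1`.
Finally, with `N = η^(-1/2)`, inflating the variance by `M = max 1 (N / d)` absorbs design points of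
very large norm: it costs `a log M` in the prior and a multiple of `α N` in the likelihood. With
`Λ = s log (Cx C₁ √(nd) / s)` the result is `-log ∫ R dπ ≤ A₀ Λ + a log M + A₁ α N`, to be compared
with the target `(1 + α) c Λ + α N √(c Λ)`.

If `log M ≤ K (Λ + α N)` for a suitable constant `K`, this bound fits the target, and `F = -n log A`,
for which `∫ e^F Aⁿ dπ ≤ 1`, gives the claim. Otherwise `log N` is much larger than `Λ` and `α N`, so
that `n`, `d` and `Cx C₁` are small powers of `N` while `α` is about `1/N` up to logarithms. Then
`-log A ≤ α KL` is so small that even `n log N (-log A)` is at most a function of `σ` with a bounded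
exponential moment under the prior (`mul_negLogAffinity_le_of_dominated`). With that function as `F`
the bound is of order `log N`, and the division by `log N` leaves a constant.
-/

noncomputable section

variable {n d : ℕ}

/-! ### Integration on product spaces, and Jensen's inequality -/

theorem lintegral_pi_prod_eq_prod {ι : Type*} [Fintype ι] {E : ι → Type*}
    [∀ i, MeasurableSpace (E i)] (μ : ∀ i, Measure (E i)) [∀ i, IsProbabilityMeasure (μ i)]
    (f : ∀ i, E i → ℝ≥0∞) (hf : ∀ i, Measurable (f i)) :
    ∫⁻ z, ∏ i, f i (z i) ∂(Measure.pi μ) = ∏ i, ∫⁻ x, f i x ∂(μ i) := by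
  have h := lintegral_prod_eq_prod_lintegral_of_indepFun Finset.univ
    (fun i (z : ∀ i, E i) => f i (z i))
    (iIndepFun_pi (μ := μ) (X := f) fun i => (hf i).aemeasurable)
    (fun i => (hf i).comp (measurable_pi_apply i))
  rw [h]
  exact Finset.prod_congr rfl fun i _ => (measurePreserving_eval μ i).lintegral_comp (hf i)

/-- A product of probability measures with positive densities with respect to `μ` has the product
density with respect to the product of copies of `μ`. -/
theorem pi_withDensity_eq {ι : Type*} [Fintype ι] {E : Type*} [MeasurableSpace E]
    (μ : Measure E) [SigmaFinite μ] (g : E → ℝ≥0∞) (hg : Measurable g) (hg0 : ∀ x, g x ≠ 0)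
    (hgt : ∀ x, g x ≠ ∞) [IsProbabilityMeasure (μ.withDensity g)] :
    Measure.pi (fun _ : ι => μ.withDensity g)
      = (Measure.pi fun _ : ι => μ).withDensity fun x => ∏ i, g (x i) := by
  set S := μ.withDensity g
  have hμ : S.withDensity (fun x => (g x)⁻¹) = μ :=
    withDensity_inv_same hg (ae_of_all _ hg0) (ae_of_all _ hgt)
  have hmg : Measurable fun x : ι → E => ∏ i, g (x i) :=
    Finset.measurable_prod _ fun i _ => hg.comp (measurable_pi_apply i)
  -- On boxes the inverse density can be integrated coordinate by coordinate, because `S` is a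
  -- probability measure; this identifies `μ ^ ι` as `S ^ ι` with the inverse density.
  have key : (Measure.pi fun _ : ι => μ)
      = (Measure.pi fun _ : ι => S).withDensity fun x => ∏ i, (g (x i))⁻¹ := by
    refine Measure.pi_eq fun s hs => ?_
    rw [withDensity_apply _ (MeasurableSet.univ_pi hs),
      ← lintegral_indicator (MeasurableSet.univ_pi hs)]
    have h1 : (Set.univ.pi s).indicator (fun x : ι → E => ∏ i, (g (x i))⁻¹)
        = fun x => ∏ i, (s i).indicator (fun y => (g y)⁻¹) (x i) := by
      funext x
      by_cases hx : x ∈ Set.univ.pi s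
      · rw [Set.indicator_of_mem hx]
        exact Finset.prod_congr rfl fun i _ => by
          rw [Set.indicator_of_mem (hx i (Set.mem_univ i))]
      · rw [Set.indicator_of_notMem hx]
        obtain ⟨i, hi⟩ : ∃ i, x i ∉ s i := by simpa [Set.mem_pi] using hx
        exact (Finset.prod_eq_zero (Finset.mem_univ i) (Set.indicator_of_notMem hi _)).symm
    rw [h1]
    refine (lintegral_pi_prod_eq_prod (fun _ : ι => S) (fun i => (s i).indicator fun y => (g y)⁻¹)
      fun i => hg.inv.indicator (hs i)).trans ?_
    refine Finset.prod_congr rfl fun i _ => ?_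
    rw [lintegral_indicator (hs i), ← withDensity_apply _ (hs i), hμ]
  have hinv : (fun x : ι → E => ∏ i, (g (x i))⁻¹) = fun x => (∏ i, g (x i))⁻¹ := by
    funext x
    exact (ENNReal.prod_inv_distrib fun i _ j _ _ => Or.inl (hg0 _)).symm
  have hne0 : ∀ x : ι → E, ∏ i, g (x i) ≠ 0 := fun x => Finset.prod_ne_zero_iff.2 fun i _ => hg0 _
  have hnet : ∀ x : ι → E, ∏ i, g (x i) ≠ ∞ := fun x => ENNReal.prod_ne_top fun i _ => hgt _
  rw [key, hinv]
  refine Eq.trans ?_ (withDensity_mul _ hmg.inv hmg)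
  have h2 : ((fun x : ι → E => (∏ i, g (x i))⁻¹) * fun x => ∏ i, g (x i)) = 1 := by
    funext x
    simpa using ENNReal.inv_mul_cancel (hne0 x) (hnet x)
  rw [h2, withDensity_one]

/-- Jensen's inequality for the exponential, free of integrability assumptions. -/
theorem lintegral_le_of_lintegral_exp_le {Ω : Type*} [MeasurableSpace Ω] (Q : Measure Ω)
    [IsProbabilityMeasure Q] (F : Ω → ℝ) (hF : Measurable F) (hF0 : ∀ᵐ ω ∂Q, 0 ≤ F ω) (t : ℝ)
    (h : ∫⁻ ω, ENNReal.ofReal (Real.exp (F ω)) ∂Q ≤ ENNReal.ofReal (Real.exp t)) :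
    ∫⁻ ω, ENNReal.ofReal (F ω) ∂Q ≤ ENNReal.ofReal t := by
  have ht : 0 ≤ t := by
    have h1 : (1 : ℝ≥0∞) ≤ ENNReal.ofReal (Real.exp t) := by
      refine le_trans ?_ h
      calc (1 : ℝ≥0∞) = ∫⁻ _, 1 ∂Q := by simp
        _ ≤ _ := lintegral_mono_ae (hF0.mono fun ω hω => by
            simpa using Real.one_le_exp hω)
    rw [ENNReal.one_le_ofReal] at h1
    exact Real.one_le_exp_iff.1 h1
  have hm : Measurable fun ω => ENNReal.ofReal (Real.exp (F ω)) := by fun_prop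
  -- the tangent line of the exponential at `t`
  have key : ∫⁻ ω, (ENNReal.ofReal (F ω) + 1) ∂Q ≤ ENNReal.ofReal t + 1 := by
    calc ∫⁻ ω, (ENNReal.ofReal (F ω) + 1) ∂Q
        ≤ ∫⁻ ω, (ENNReal.ofReal (Real.exp (-t)) * ENNReal.ofReal (Real.exp (F ω))
            + ENNReal.ofReal t) ∂Q := by
          refine lintegral_mono_ae (hF0.mono fun ω hω => ?_)
          rw [← ENNReal.ofReal_mul (Real.exp_pos _).le, ← Real.exp_add, ← ENNReal.ofReal_one,
            ← ENNReal.ofReal_add hω zero_le_one, ← ENNReal.ofReal_add (Real.exp_pos _).le ht]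
          refine ENNReal.ofReal_le_ofReal ?_
          have := Real.add_one_le_exp (-t + F ω)
          linarith
      _ = ENNReal.ofReal (Real.exp (-t)) * ∫⁻ ω, ENNReal.ofReal (Real.exp (F ω)) ∂Q
            + ENNReal.ofReal t := by
          rw [lintegral_add_right _ measurable_const, lintegral_const_mul _ hm]
          simp
      _ ≤ ENNReal.ofReal (Real.exp (-t)) * ENNReal.ofReal (Real.exp t) + ENNReal.ofReal t := by
          gcongr
      _ = ENNReal.ofReal t + 1 := by
          rw [← ENNReal.ofReal_mul (Real.exp_pos _).le, ← Real.exp_add]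
          simp [add_comm]
  rw [lintegral_add_right _ measurable_const] at key
  simpa using key

/-- Jensen's inequality for the reciprocal exponential, free of integrability assumptions. -/
theorem exp_neg_le_lintegral_exp_neg {Ω : Type*} [MeasurableSpace Ω] (Q : Measure Ω)
    [IsProbabilityMeasure Q] (W : Ω → ℝ) (hW : Measurable W) (hW0 : ∀ ω, 0 ≤ W ω) (w : ℝ)
    (hw : 0 ≤ w) (h : ∫⁻ ω, ENNReal.ofReal (W ω) ∂Q ≤ ENNReal.ofReal w) :
    ENNReal.ofReal (Real.exp (-w)) ≤ ∫⁻ ω, ENNReal.ofReal (Real.exp (-W ω)) ∂Q := by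
  have hm : Measurable fun ω => ENNReal.ofReal (W ω) := by fun_prop
  set c := ENNReal.ofReal (Real.exp (-w)) with hc
  have key : c * (1 + ENNReal.ofReal w)
      ≤ ∫⁻ ω, ENNReal.ofReal (Real.exp (-W ω)) ∂Q + c * ENNReal.ofReal w := by
    calc c * (1 + ENNReal.ofReal w) = ∫⁻ _, c * (1 + ENNReal.ofReal w) ∂Q := by simp
      _ ≤ ∫⁻ ω, (ENNReal.ofReal (Real.exp (-W ω)) + c * ENNReal.ofReal (W ω)) ∂Q := by
          refine lintegral_mono fun ω => ?_
          rw [hc, ← ENNReal.ofReal_one, ← ENNReal.ofReal_add zero_le_one hw,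
            ← ENNReal.ofReal_mul (Real.exp_pos _).le, ← ENNReal.ofReal_mul (Real.exp_pos _).le,
            ← ENNReal.ofReal_add (Real.exp_pos _).le (mul_nonneg (Real.exp_pos _).le (hW0 ω))]
          refine ENNReal.ofReal_le_ofReal ?_
          have h1 := Real.add_one_le_exp (w - W ω)
          have h2 : Real.exp (-W ω) = Real.exp (-w) * Real.exp (w - W ω) := by
            rw [← Real.exp_add]; congr 1; ring
          rw [h2, ← mul_add]
          exact mul_le_mul_of_nonneg_left (by linarith) (Real.exp_pos _).le
      _ = ∫⁻ ω, ENNReal.ofReal (Real.exp (-W ω)) ∂Q + c * ∫⁻ ω, ENNReal.ofReal (W ω) ∂Q := by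
          rw [lintegral_add_right _ (hm.const_mul c), lintegral_const_mul _ hm]
      _ ≤ _ := by gcongr
  rw [mul_add, mul_one] at key
  exact (ENNReal.add_le_add_iff_right
    (ENNReal.mul_ne_top ENNReal.ofReal_ne_top ENNReal.ofReal_ne_top)).1 key

/-- The truncated symmetrization inequality `𝔼[1_G exp(w - q)] ≥ 𝔼[1_G exp(-q)]` for a symmetric
law, an odd `w` and an even `q`: it is `cosh ≥ 1`. -/
theorem lintegral_indicator_exp_odd_ge {E : Type*} [MeasurableSpace E] [InvolutiveNeg E]
    [MeasurableNeg E]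
    (S : Measure E) (hS : S.map (fun x => -x) = S) (G : Set E) (hG : MeasurableSet G)
    (hGs : ∀ x, x ∈ G → -x ∈ G) (w : E → ℝ) (hw : Measurable w) (hodd : ∀ x, w (-x) = -w x) :
    S G ≤ ∫⁻ x, G.indicator (fun x => ENNReal.ofReal (Real.exp (w x))) x ∂S := by
  have hm : Measurable (G.indicator fun x => ENNReal.ofReal (Real.exp (w x))) :=
    Measurable.indicator (by fun_prop) hG
  set I := ∫⁻ x, G.indicator (fun x => ENNReal.ofReal (Real.exp (w x))) x ∂S with hI
  have h1 : I = ∫⁻ x, G.indicator (fun x => ENNReal.ofReal (Real.exp (-w x))) x ∂S := by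
    conv_lhs => rw [hI, ← hS, lintegral_map hm measurable_neg]
    refine lintegral_congr fun x => ?_
    by_cases hx : x ∈ G
    · rw [Set.indicator_of_mem hx, Set.indicator_of_mem (hGs x hx), hodd]
    · rw [Set.indicator_of_notMem hx, Set.indicator_of_notMem fun h => hx (by simpa using hGs _ h)]
  have h2 : S G + S G ≤ I + I := by
    nth_rewrite 2 [h1]
    rw [hI, ← lintegral_add_left hm, ← two_mul, ← lintegral_indicator_one hG,
      ← lintegral_const_mul _ (measurable_one.indicator hG)]
    refine lintegral_mono fun x => ?_
    by_cases hx : x ∈ G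
    · simp only [Set.indicator_of_mem hx, Pi.one_apply, mul_one]
      rw [← ENNReal.ofReal_add (Real.exp_pos _).le (Real.exp_pos _).le]
      have h2' : (2 : ℝ≥0∞) = ENNReal.ofReal 2 := by simp
      rw [h2']
      refine ENNReal.ofReal_le_ofReal ?_
      have := Real.one_le_cosh (w x)
      rw [Real.cosh_eq] at this
      linarith
    · simp [Set.indicator_of_notMem hx]
  rw [← two_mul, ← two_mul] at h2
  exact (ENNReal.mul_le_mul_iff_right (by simp) (by simp)).1 h2

/-! ### The inverse-gamma distribution -/

theorem lintegral_rpow_mul_exp_neg_div {p β : ℝ} (hp : 0 < p) (hβ : 0 < β) :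
    ∫⁻ x in Set.Ioi (0 : ℝ), ENNReal.ofReal (x ^ (-p - 1) * Real.exp (-β / x))
      = ENNReal.ofReal (Real.Gamma p * β ^ (-p)) := by
  have h1 : ∫ x in Set.Ioi (0 : ℝ), x ^ (-p - 1) * Real.exp (-β / x)
      = Real.Gamma p * β ^ (-p) := by
    have h := integral_comp_rpow_Ioi (fun y : ℝ => y ^ (p - 1) * Real.exp (-(β * y)))
      (p := -1) (by norm_num)
    rw [Real.integral_rpow_mul_exp_neg_mul_Ioi hp hβ] at h
    rw [Real.rpow_neg hβ.le, mul_comm (Real.Gamma p), ← Real.inv_rpow hβ.le, ← one_div, ← h]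
    refine setIntegral_congr_fun measurableSet_Ioi fun x hx => ?_
    have hx' : (0 : ℝ) < x := hx
    have h2 : (x ^ (-1 : ℝ)) ^ (p - 1) = x ^ (-(p - 1)) := by
      rw [← Real.rpow_mul hx'.le]; congr 1; ring
    simp only [abs_neg, abs_one, one_mul, smul_eq_mul]
    rw [h2, ← mul_assoc, ← Real.rpow_add hx', Real.rpow_neg_one]
    congr 2
    · ring
    · field_simp
  have hpos : 0 < Real.Gamma p * β ^ (-p) :=
    mul_pos (Real.Gamma_pos_of_pos hp) (Real.rpow_pos_of_pos hβ _)
  have hint : IntegrableOn (fun x : ℝ => x ^ (-p - 1) * Real.exp (-β / x)) (Set.Ioi 0) := by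
    by_contra hc
    rw [integral_undef hc] at h1
    exact hpos.ne h1
  rw [← h1, ofReal_integral_eq_lintegral_ofReal hint]
  filter_upwards [ae_restrict_mem measurableSet_Ioi] with x hx
  exact mul_nonneg (Real.rpow_nonneg (le_of_lt hx) _) (Real.exp_pos _).le

/-! ### The scaled Student distribution -/

/-- The unnormalized scaled Student density `(τ² + x²)⁻²` on the line. -/
def studentWeight (τ x : ℝ) : ℝ := ((τ ^ 2 + x ^ 2) ^ 2)⁻¹

/-- The probability measure on the line with density proportional to `(τ² + x²)⁻²`. -/
def studentLaw (τ : ℝ) : Measure ℝ :=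
  volume.withDensity fun x =>
    (∫⁻ y, ENNReal.ofReal (studentWeight τ y))⁻¹ * ENNReal.ofReal (studentWeight τ x)

theorem studentWeight_pos {τ : ℝ} (hτ : 0 < τ) (x : ℝ) : 0 < studentWeight τ x := by
  unfold studentWeight; positivity

theorem measurable_studentWeight (τ : ℝ) : Measurable (studentWeight τ) := by
  unfold studentWeight; fun_prop

theorem integrable_inv_sq_add_sq {τ : ℝ} (hτ : 0 < τ) :
    Integrable fun x : ℝ => (τ ^ 2 + x ^ 2)⁻¹ := by
  have h := (integrable_inv_one_add_sq.comp_div hτ.ne').const_mul (τ ^ 2)⁻¹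
  refine h.congr (ae_of_all _ fun x => ?_)
  simp only
  rw [← mul_inv]
  congr 1
  field_simp

theorem integrable_studentWeight {τ : ℝ} (hτ : 0 < τ) : Integrable (studentWeight τ) := by
  refine ((integrable_inv_sq_add_sq hτ).const_mul (τ ^ 2)⁻¹).mono'
    (measurable_studentWeight τ).aestronglyMeasurable (ae_of_all _ fun x => ?_)
  rw [Real.norm_of_nonneg (studentWeight_pos hτ x).le, studentWeight, ← mul_inv, sq (τ ^ 2 + x ^ 2)]
  gcongr
  nlinarith [sq_nonneg x]

theorem integrable_sq_mul_studentWeight {τ : ℝ} (hτ : 0 < τ) :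
    Integrable fun x => x ^ 2 * studentWeight τ x := by
  refine (integrable_inv_sq_add_sq hτ).mono'
    ((measurable_id.pow_const 2).mul (measurable_studentWeight τ)).aestronglyMeasurable
    (ae_of_all _ fun x => ?_)
  rw [Real.norm_of_nonneg (mul_nonneg (sq_nonneg x) (studentWeight_pos hτ x).le), studentWeight]
  have h : 0 < τ ^ 2 + x ^ 2 := by positivity
  rw [← div_eq_mul_inv, div_le_iff₀ (by positivity), sq (τ ^ 2 + x ^ 2), ← mul_assoc,
    inv_mul_cancel₀ h.ne', one_mul]
  nlinarith [sq_nonneg τ]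

/-- The second moment identity for the Student density: `(τ² - x²)(τ² + x²)⁻²` is the derivative of
`x / (τ² + x²)`, which vanishes at both ends of the line. -/
theorem integral_sq_mul_studentWeight {τ : ℝ} (hτ : 0 < τ) :
    ∫ x, x ^ 2 * studentWeight τ x = τ ^ 2 * ∫ x, studentWeight τ x := by
  have hd : ∀ x : ℝ, HasDerivAt (fun x : ℝ => x / (τ ^ 2 + x ^ 2))
      (τ ^ 2 * studentWeight τ x - x ^ 2 * studentWeight τ x) x := by
    intro x
    have h : τ ^ 2 + x ^ 2 ≠ 0 := by positivity
    have h1 : HasDerivAt (fun x : ℝ => τ ^ 2 + x ^ 2) (2 * x) x := by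
      simpa using (hasDerivAt_pow 2 x).const_add (τ ^ 2)
    refine ((hasDerivAt_id x).div h1 h).congr_deriv ?_
    simp only [studentWeight, id]
    field_simp
    ring
  have hbound : ∀ x : ℝ, x ≠ 0 → ‖x / (τ ^ 2 + x ^ 2)‖ ≤ |x|⁻¹ := by
    intro x hx
    have hx' : 0 < |x| := abs_pos.2 hx
    rw [norm_div, Real.norm_eq_abs, Real.norm_of_nonneg (by positivity), div_le_iff₀ (by positivity),
      inv_mul_eq_div, le_div_iff₀ hx', ← sq_abs x]
    nlinarith [sq_nonneg τ]
  have htop : Filter.Tendsto (fun x : ℝ => x / (τ ^ 2 + x ^ 2)) Filter.atTop (nhds 0) :=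
    squeeze_zero_norm' ((Filter.eventually_ne_atTop 0).mono hbound)
      (tendsto_inv_atTop_zero.comp Filter.tendsto_abs_atTop_atTop)
  have hbot : Filter.Tendsto (fun x : ℝ => x / (τ ^ 2 + x ^ 2)) Filter.atBot (nhds 0) :=
    squeeze_zero_norm' ((Filter.eventually_ne_atBot 0).mono hbound)
      (tendsto_inv_atTop_zero.comp Filter.tendsto_abs_atBot_atTop)
  have h := integral_of_hasDerivAt_of_tendsto hd
    (((integrable_studentWeight hτ).const_mul _).sub (integrable_sq_mul_studentWeight hτ)) hbot htop
  rw [integral_sub ((integrable_studentWeight hτ).const_mul _) (integrable_sq_mul_studentWeight hτ),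
    integral_const_mul] at h
  linarith

theorem lintegral_studentWeight_ne_zero {τ : ℝ} (hτ : 0 < τ) :
    ∫⁻ y, ENNReal.ofReal (studentWeight τ y) ≠ 0 := by
  rw [← pos_iff_ne_zero, lintegral_pos_iff_support (measurable_studentWeight τ).ennreal_ofReal]
  have : Function.support (fun y => ENNReal.ofReal (studentWeight τ y)) = Set.univ := by
    ext x; simpa using studentWeight_pos hτ x
  simp [this]

theorem lintegral_studentWeight_ne_top {τ : ℝ} (hτ : 0 < τ) :
    ∫⁻ y, ENNReal.ofReal (studentWeight τ y) ≠ ∞ :=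
  (integrable_studentWeight hτ).lintegral_lt_top.ne

theorem isProbabilityMeasure_studentLaw {τ : ℝ} (hτ : 0 < τ) :
    IsProbabilityMeasure (studentLaw τ) := by
  constructor
  rw [studentLaw, withDensity_apply _ MeasurableSet.univ, Measure.restrict_univ,
    lintegral_const_mul _ (measurable_studentWeight τ).ennreal_ofReal]
  exact ENNReal.inv_mul_cancel (lintegral_studentWeight_ne_zero hτ)
    (lintegral_studentWeight_ne_top hτ)

theorem map_neg_studentLaw (τ : ℝ) : (studentLaw τ).map (fun x => -x) = studentLaw τ := by
  have hm : Measurable fun x => (∫⁻ y, ENNReal.ofReal (studentWeight τ y))⁻¹ *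
      ENNReal.ofReal (studentWeight τ x) :=
    (measurable_studentWeight τ).ennreal_ofReal.const_mul _
  ext s hs
  rw [Measure.map_apply measurable_neg hs, studentLaw, withDensity_apply _ hs,
    withDensity_apply _ (measurable_neg hs), ← lintegral_indicator hs,
    ← lintegral_indicator (measurable_neg hs),
    ← (Measure.measurePreserving_neg (volume : Measure ℝ)).lintegral_comp (hm.indicator hs)]
  refine lintegral_congr fun x => ?_
  simp only [Set.indicator, Set.mem_preimage, studentWeight, neg_sq]
  rfl

theorem lintegral_sq_studentLaw {τ : ℝ} (hτ : 0 < τ) :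
    ∫⁻ x, ENNReal.ofReal (x ^ 2) ∂(studentLaw τ) = ENNReal.ofReal (τ ^ 2) := by
  have hm := (measurable_studentWeight τ).ennreal_ofReal
  rw [studentLaw, lintegral_withDensity_eq_lintegral_mul _ (hm.const_mul _) (by fun_prop)]
  have h1 : ∫⁻ x, ENNReal.ofReal (x ^ 2 * studentWeight τ x)
      = ENNReal.ofReal (τ ^ 2) * ∫⁻ x, ENNReal.ofReal (studentWeight τ x) := by
    rw [← ofReal_integral_eq_lintegral_ofReal (integrable_sq_mul_studentWeight hτ)
      (ae_of_all _ fun x => mul_nonneg (sq_nonneg x) (studentWeight_pos hτ x).le),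
      ← ofReal_integral_eq_lintegral_ofReal (integrable_studentWeight hτ)
      (ae_of_all _ fun x => (studentWeight_pos hτ x).le),
      integral_sq_mul_studentWeight hτ, ENNReal.ofReal_mul (sq_nonneg τ)]
  have h2 : ∀ x, ((fun x => (∫⁻ y, ENNReal.ofReal (studentWeight τ y))⁻¹ *
      ENNReal.ofReal (studentWeight τ x)) * fun x => ENNReal.ofReal (x ^ 2)) x
      = (∫⁻ y, ENNReal.ofReal (studentWeight τ y))⁻¹
        * ENNReal.ofReal (x ^ 2 * studentWeight τ x) := by
    intro x
    rw [ENNReal.ofReal_mul (sq_nonneg x), Pi.mul_apply]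
    ring
  simp_rw [h2]
  rw [lintegral_const_mul _ (by have := measurable_studentWeight τ; fun_prop), h1,
    mul_comm (ENNReal.ofReal (τ ^ 2)), ← mul_assoc,
    ENNReal.inv_mul_cancel (lintegral_studentWeight_ne_zero hτ)
    (lintegral_studentWeight_ne_top hτ), one_mul]

theorem lintegral_abs_studentLaw_le {τ : ℝ} (hτ : 0 < τ) :
    ∫⁻ x, ENNReal.ofReal |x| ∂(studentLaw τ) ≤ ENNReal.ofReal τ := by
  have := isProbabilityMeasure_studentLaw hτ
  calc ∫⁻ x, ENNReal.ofReal |x| ∂(studentLaw τ)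
      ≤ ∫⁻ x, (ENNReal.ofReal (1 / (2 * τ)) * ENNReal.ofReal (x ^ 2) + ENNReal.ofReal (τ / 2))
          ∂(studentLaw τ) := by
        refine lintegral_mono fun x => ?_
        rw [← ENNReal.ofReal_mul (by positivity), ← ENNReal.ofReal_add (by positivity)
          (by positivity)]
        refine ENNReal.ofReal_le_ofReal ?_
        have h : 1 / (2 * τ) * x ^ 2 + τ / 2 - |x| = (|x| - τ) ^ 2 / (2 * τ) := by
          rw [← sq_abs x]; field_simp; ring
        have : 0 ≤ (|x| - τ) ^ 2 / (2 * τ) := by positivity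
        linarith
    _ = ENNReal.ofReal τ := by
        rw [lintegral_add_right _ measurable_const, lintegral_const_mul _ (by fun_prop),
          lintegral_sq_studentLaw hτ, ← ENNReal.ofReal_mul (by positivity)]
        simp only [lintegral_const, measure_univ, mul_one]
        rw [← ENNReal.ofReal_add (by positivity) (by positivity)]
        congr 1
        field_simp
        ring

/-- Coordinates of the product Student law are centred and independent with variance `τ²`. -/
theorem lintegral_dotProduct_sq_pi_studentLaw {d : ℕ} {τ : ℝ} (hτ : 0 < τ) (x : Fin d → ℝ) :
    ∫⁻ ξ, ENNReal.ofReal ((x ⬝ᵥ ξ) ^ 2) ∂(Measure.pi fun _ : Fin d => studentLaw τ)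
      = ENNReal.ofReal (τ ^ 2 * ∑ j, x j ^ 2) := by
  have := isProbabilityMeasure_studentLaw hτ
  have hsq : Integrable (fun y : ℝ => y ^ 2) (studentLaw τ) := by
    refine ⟨by fun_prop, ?_⟩
    rw [hasFiniteIntegral_iff_ofReal (ae_of_all _ fun y => sq_nonneg y), lintegral_sq_studentLaw hτ]
    exact ENNReal.ofReal_lt_top
  have hint : ∫ y, y ^ 2 ∂(studentLaw τ) = τ ^ 2 := by
    rw [integral_eq_lintegral_of_nonneg_ae (ae_of_all _ fun y => sq_nonneg y) (by fun_prop),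
      lintegral_sq_studentLaw hτ, ENNReal.toReal_ofReal (sq_nonneg τ)]
  have hid : MemLp (id : ℝ → ℝ) 2 (studentLaw τ) := by
    rw [memLp_two_iff_integrable_sq (by fun_prop)]
    exact hsq
  have hmean : ∫ y, y ∂(studentLaw τ) = 0 := by
    have h : ∫ y, y ∂(studentLaw τ) = -∫ y, y ∂(studentLaw τ) := by
      conv_lhs => rw [← map_neg_studentLaw τ]
      rw [integral_map (by fun_prop) (by fun_prop), integral_neg]
    linarith
  have hX : ∀ j, MemLp (fun y : ℝ => x j * y) 2 (studentLaw τ) := fun j => hid.const_mul (x j)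
  have hvar := variance_sum_pi (μ := fun _ : Fin d => studentLaw τ) (X := fun j y => x j * y) hX
  have hfun : (∑ j, fun ξ : Fin d → ℝ => x j * ξ j) = fun ξ => x ⬝ᵥ ξ := by
    funext ξ; simp [dotProduct]
  have hXi : ∀ j, MemLp (fun ξ : Fin d → ℝ => x j * ξ j) 2
      (Measure.pi fun _ : Fin d => studentLaw τ) := fun j =>
    (hX j).comp_measurePreserving (measurePreserving_eval (fun _ : Fin d => studentLaw τ) j)
  have hdot : MemLp (fun ξ : Fin d → ℝ => x ⬝ᵥ ξ) 2
      (Measure.pi fun _ : Fin d => studentLaw τ) := by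
    rw [← hfun]; exact memLp_finsetSum' _ fun j _ => hXi j
  have hmean' : ∫ ξ, x ⬝ᵥ ξ ∂(Measure.pi fun _ : Fin d => studentLaw τ) = 0 := by
    simp only [dotProduct]
    rw [integral_finsetSum _ fun j _ => (hXi j).integrable (by norm_num)]
    refine Finset.sum_eq_zero fun j _ => ?_
    rw [integral_const_mul, integral_eval, hmean, mul_zero]
  rw [hfun, variance_of_integral_eq_zero hdot.1.aemeasurable hmean'] at hvar
  rw [← ofReal_integral_eq_lintegral_ofReal hdot.integrable_sq (ae_of_all _ fun ξ => sq_nonneg _)]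
  congr 1
  refine hvar.trans ?_
  rw [Finset.mul_sum]
  refine Finset.sum_congr rfl fun j _ => ?_
  rw [variance_of_integral_eq_zero (by fun_prop) (by rw [integral_const_mul, hmean, mul_zero])]
  simp only [mul_pow]
  rw [integral_const_mul, hint, mul_comm]

theorem map_neg_pi_studentLaw {d : ℕ} {τ : ℝ} (hτ : 0 < τ) :
    (Measure.pi fun _ : Fin d => studentLaw τ).map (fun ξ => -ξ)
      = Measure.pi fun _ : Fin d => studentLaw τ := by
  have := isProbabilityMeasure_studentLaw hτ
  exact (measurePreserving_pi (fun _ : Fin d => studentLaw τ) (fun _ : Fin d => studentLaw τ)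
    (f := fun _ x => -x) fun _ => ⟨measurable_neg, map_neg_studentLaw τ⟩).map_eq

/-- A quarter of the mass of the product Student law sits on the `ℓ¹` ball of radius `2dτ`
intersected with the region where a quadratic form is at most four times its mean. -/
theorem quarter_le_pi_studentLaw {n d : ℕ} {τ q : ℝ} (hd : 0 < d) (hτ : 0 < τ) (hq : 0 < q)
    (x : Fin n → Fin d → ℝ) (hx : τ ^ 2 * ∑ i, ∑ j, x i j ^ 2 ≤ q) :
    ENNReal.ofReal (1 / 4) ≤ (Measure.pi fun _ : Fin d => studentLaw τ)
      {ξ | ∑ j, |ξ j| ≤ 2 * d * τ ∧ ∑ i, (x i ⬝ᵥ ξ) ^ 2 ≤ 4 * q} := by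
  have := isProbabilityMeasure_studentLaw hτ
  set S := Measure.pi fun _ : Fin d => studentLaw τ with hS
  have hdR : (0 : ℝ) < d := by exact_mod_cast hd
  have hmdot : ∀ i, Measurable fun ξ : Fin d → ℝ => x i ⬝ᵥ ξ := fun i => by
    unfold dotProduct; fun_prop
  have hA : S {ξ | 2 * d * τ ≤ ∑ j, |ξ j|} ≤ ENNReal.ofReal (1 / 2) := by
    have h1 : ∫⁻ ξ, ENNReal.ofReal (∑ j, |ξ j|) ∂S ≤ ENNReal.ofReal (d * τ) := by
      calc ∫⁻ ξ, ENNReal.ofReal (∑ j, |ξ j|) ∂S = ∫⁻ ξ, ∑ j, ENNReal.ofReal |ξ j| ∂S := by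
            refine lintegral_congr fun ξ => ?_
            rw [ENNReal.ofReal_sum_of_nonneg fun j _ => abs_nonneg _]
        _ = ∑ j : Fin d, ∫⁻ y, ENNReal.ofReal |y| ∂(studentLaw τ) := by
            rw [lintegral_finsetSum _ fun j _ => by fun_prop]
            refine Finset.sum_congr rfl fun j _ => ?_
            exact (measurePreserving_eval (fun _ : Fin d => studentLaw τ) j).lintegral_comp
              (f := fun y => ENNReal.ofReal |y|) (by fun_prop)
        _ ≤ ∑ j : Fin d, ENNReal.ofReal τ :=
            Finset.sum_le_sum fun j _ => lintegral_abs_studentLaw_le hτ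
        _ = ENNReal.ofReal (d * τ) := by
            simp [ENNReal.ofReal_mul hdR.le]
    have h2 := meas_ge_le_lintegral_div (μ := S)
      (f := fun ξ : Fin d → ℝ => ENNReal.ofReal (∑ j, |ξ j|))
      (Measurable.aemeasurable (by fun_prop))
      (ε := ENNReal.ofReal (2 * d * τ)) (ENNReal.ofReal_pos.2 (by positivity)).ne' ENNReal.ofReal_ne_top
    calc S {ξ | 2 * d * τ ≤ ∑ j, |ξ j|}
        ≤ S {ξ | ENNReal.ofReal (2 * d * τ) ≤ ENNReal.ofReal (∑ j, |ξ j|)} :=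
          measure_mono fun ξ hξ => ENNReal.ofReal_le_ofReal hξ
      _ ≤ ENNReal.ofReal (d * τ) / ENNReal.ofReal (2 * d * τ) := h2.trans (by gcongr)
      _ = ENNReal.ofReal (1 / 2) := by
          rw [← ENNReal.ofReal_div_of_pos (by positivity)]
          congr 1; field_simp
  have hB : S {ξ | 4 * q ≤ ∑ i, (x i ⬝ᵥ ξ) ^ 2} ≤ ENNReal.ofReal (1 / 4) := by
    have h1 : ∫⁻ ξ, ENNReal.ofReal (∑ i, (x i ⬝ᵥ ξ) ^ 2) ∂S ≤ ENNReal.ofReal q := by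
      calc ∫⁻ ξ, ENNReal.ofReal (∑ i, (x i ⬝ᵥ ξ) ^ 2) ∂S
          = ∫⁻ ξ, ∑ i, ENNReal.ofReal ((x i ⬝ᵥ ξ) ^ 2) ∂S := by
            refine lintegral_congr fun ξ => ?_
            rw [ENNReal.ofReal_sum_of_nonneg fun j _ => sq_nonneg _]
        _ = ∑ i, ENNReal.ofReal (τ ^ 2 * ∑ j, x i j ^ 2) := by
            rw [lintegral_finsetSum _ fun i _ => by have := hmdot i; fun_prop]
            exact Finset.sum_congr rfl fun i _ => lintegral_dotProduct_sq_pi_studentLaw hτ (x i)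
        _ ≤ ENNReal.ofReal q := by
            rw [← ENNReal.ofReal_sum_of_nonneg fun i _ =>
              mul_nonneg (sq_nonneg τ) (Finset.sum_nonneg fun j _ => sq_nonneg _), ← Finset.mul_sum]
            exact ENNReal.ofReal_le_ofReal hx
    have h2 := meas_ge_le_lintegral_div (μ := S)
      (f := fun ξ : Fin d → ℝ => ENNReal.ofReal (∑ i, (x i ⬝ᵥ ξ) ^ 2)) (by fun_prop)
      (ε := ENNReal.ofReal (4 * q)) (ENNReal.ofReal_pos.2 (by positivity)).ne' ENNReal.ofReal_ne_top
    calc S {ξ | 4 * q ≤ ∑ i, (x i ⬝ᵥ ξ) ^ 2}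
        ≤ S {ξ | ENNReal.ofReal (4 * q) ≤ ENNReal.ofReal (∑ i, (x i ⬝ᵥ ξ) ^ 2)} :=
          measure_mono fun ξ hξ => ENNReal.ofReal_le_ofReal hξ
      _ ≤ ENNReal.ofReal q / ENNReal.ofReal (4 * q) := h2.trans (by gcongr)
      _ = ENNReal.ofReal (1 / 4) := by
          rw [← ENNReal.ofReal_div_of_pos (by positivity)]
          congr 1; field_simp
  set G := {ξ : Fin d → ℝ | ∑ j, |ξ j| ≤ 2 * d * τ ∧ ∑ i, (x i ⬝ᵥ ξ) ^ 2 ≤ 4 * q} with hG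
  have hcover : (Set.univ : Set (Fin d → ℝ))
      ⊆ G ∪ ({ξ | 2 * d * τ ≤ ∑ j, |ξ j|} ∪ {ξ | 4 * q ≤ ∑ i, (x i ⬝ᵥ ξ) ^ 2}) := by
    intro ξ _
    by_cases h1 : 2 * d * τ ≤ ∑ j, |ξ j|
    · exact Or.inr (Or.inl h1)
    by_cases h2 : 4 * q ≤ ∑ i, (x i ⬝ᵥ ξ) ^ 2
    · exact Or.inr (Or.inr h2)
    exact Or.inl ⟨(not_le.1 h1).le, (not_le.1 h2).le⟩
  have h3 : ENNReal.ofReal (1 / 4) + ENNReal.ofReal (3 / 4) ≤ S G + ENNReal.ofReal (3 / 4) := by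
    rw [← ENNReal.ofReal_add (by norm_num) (by norm_num)]
    calc ENNReal.ofReal (1 / 4 + 3 / 4) = S Set.univ := by rw [measure_univ]; norm_num
      _ ≤ S G + (S {ξ | 2 * d * τ ≤ ∑ j, |ξ j|} + S {ξ | 4 * q ≤ ∑ i, (x i ⬝ᵥ ξ) ^ 2}) :=
          (measure_mono hcover).trans ((measure_union_le _ _).trans
            (add_le_add le_rfl (measure_union_le _ _)))
      _ ≤ S G + (ENNReal.ofReal (1 / 2) + ENNReal.ofReal (1 / 4)) := by gcongr
      _ = S G + ENNReal.ofReal (3 / 4) := by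
          rw [← ENNReal.ofReal_add (by norm_num) (by norm_num)]; norm_num
  exact (ENNReal.add_le_add_iff_right ENNReal.ofReal_ne_top).1 h3

/-! ### Rényi divergences through densities -/

theorem lintegral_rnDeriv_rpow_mul_rpow {Ω : Type*} [MeasurableSpace Ω] (μ : Measure Ω)
    (f g : Ω → ℝ≥0∞) (hf : Measurable f) (hg : Measurable g) (hf0 : ∀ x, f x ≠ 0)
    (hft : ∀ x, f x ≠ ∞) (hgt : ∀ x, g x ≠ ∞) {α : ℝ} (h0 : 0 ≤ α) (h1 : α ≤ 1)
    [IsFiniteMeasure (μ.withDensity f)] [IsFiniteMeasure (μ.withDensity g)] :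
    ∫⁻ x, ((μ.withDensity f).rnDeriv (μ.withDensity f + μ.withDensity g) x) ^ α
        * ((μ.withDensity g).rnDeriv (μ.withDensity f + μ.withDensity g) x) ^ (1 - α)
        ∂(μ.withDensity f + μ.withDensity g)
      = ∫⁻ x, f x ^ α * g x ^ (1 - α) ∂μ := by
  set ρ := μ.withDensity f + μ.withDensity g with hρ
  have hsum : ρ = μ.withDensity (f + g) := (withDensity_add_left hf g).symm
  have hne0 : ∀ x, f x + g x ≠ 0 := fun x h => hf0 x (add_eq_zero.1 h).1
  have hnet : ∀ x, f x + g x ≠ ∞ := fun x => ENNReal.add_ne_top.2 ⟨hft x, hgt x⟩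
  have hwd : ∀ k : Ω → ℝ≥0∞, Measurable k →
      ρ.withDensity (fun x => k x / (f x + g x)) = μ.withDensity k := by
    intro k hk
    rw [hsum]
    refine (withDensity_mul _ (hf.add hg) (hk.div (hf.add hg))).symm.trans ?_
    congr 1
    funext x
    exact ENNReal.mul_div_cancel (hne0 x) (hnet x)
  have hderiv : ∀ k : Ω → ℝ≥0∞, Measurable k →
      (μ.withDensity k).rnDeriv ρ =ᵐ[ρ] fun x => k x / (f x + g x) := by
    intro k hk
    rw [← hwd k hk]
    exact Measure.rnDeriv_withDensity ρ (hk.div (hf.add hg))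
  have hm : Measurable fun x => (f x / (f x + g x)) ^ α * (g x / (f x + g x)) ^ (1 - α) :=
    ((hf.div (hf.add hg)).pow_const _).mul ((hg.div (hf.add hg)).pow_const _)
  calc _ = ∫⁻ x, (f x / (f x + g x)) ^ α * (g x / (f x + g x)) ^ (1 - α) ∂ρ := by
        refine lintegral_congr_ae ?_
        filter_upwards [hderiv f hf, hderiv g hg] with x h1 h2
        rw [h1, h2]
    _ = _ := by
        rw [hsum, lintegral_withDensity_eq_lintegral_mul _ (hf.add hg) hm]
        refine lintegral_congr fun x => ?_
        have h3 : (f x + g x)⁻¹ ^ α * (f x + g x)⁻¹ ^ (1 - α) = (f x + g x)⁻¹ := by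
          rw [← ENNReal.rpow_add _ _ (ENNReal.inv_ne_zero.2 (hnet x))
            (ENNReal.inv_ne_top.2 (hne0 x))]
          simp
        simp only [Pi.mul_apply, Pi.add_apply, div_eq_mul_inv]
        rw [ENNReal.mul_rpow_of_nonneg _ _ h0, ENNReal.mul_rpow_of_nonneg _ _ (sub_nonneg.2 h1)]
        calc (f x + g x) * (f x ^ α * (f x + g x)⁻¹ ^ α
              * (g x ^ (1 - α) * (f x + g x)⁻¹ ^ (1 - α)))
            = f x ^ α * g x ^ (1 - α)
              * ((f x + g x) * ((f x + g x)⁻¹ ^ α * (f x + g x)⁻¹ ^ (1 - α))) := by ring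
          _ = _ := by rw [h3, ENNReal.mul_inv_cancel (hne0 x) (hnet x), mul_one]

/-! ### The Gaussian linear model -/

theorem measurable_dotProduct_pair :
    Measurable fun q : (Fin d → ℝ) × (Fin d → ℝ) => q.1 ⬝ᵥ q.2 := by
  unfold dotProduct; fun_prop

theorem measurable_modelDensity_uncurry :
    Measurable fun q : ((Fin d → ℝ) × ℝ) × (ℝ × (Fin d → ℝ)) =>
      modelDensity q.1.1 q.1.2 q.2 := by
  have h : Measurable fun q : ((Fin d → ℝ) × ℝ) × (ℝ × (Fin d → ℝ)) => q.2.2 ⬝ᵥ q.1.1 :=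
    measurable_dotProduct_pair.comp
      ((measurable_snd.comp measurable_snd).prodMk (measurable_fst.comp measurable_fst))
  unfold modelDensity
  exact measurable_uncurry_gaussianPDF.comp
    (h.prodMk (((((measurable_snd.comp measurable_fst).pow_const 2)).real_toNNReal).prodMk
      (measurable_fst.comp measurable_snd)))

theorem toNNReal_sq_ne_zero {σ : ℝ} (hσ : 0 < σ) : (σ ^ 2).toNNReal ≠ 0 := by
  have : 0 < σ ^ 2 := by positivity
  simpa using this.ne'

theorem modelDensity_ne_zero (θ : Fin d → ℝ) {σ : ℝ} (hσ : 0 < σ) (z : ℝ × (Fin d → ℝ)) :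
    modelDensity θ σ z ≠ 0 :=
  (gaussianPDF_pos _ (toNNReal_sq_ne_zero hσ) _).ne'

theorem modelDensity_ne_top (θ : Fin d → ℝ) (σ : ℝ) (z : ℝ × (Fin d → ℝ)) :
    modelDensity θ σ z ≠ ∞ := gaussianPDF_ne_top

theorem isProbabilityMeasure_modelLaw (ν : Measure (Fin d → ℝ)) [IsProbabilityMeasure ν]
    (θ : Fin d → ℝ) (σ : ℝ) : IsProbabilityMeasure (modelLaw ν θ σ) := by
  refine Measure.isProbabilityMeasure_map (Measurable.aemeasurable ?_)
  unfold dotProduct; fun_prop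

theorem map_snd_modelLaw (ν : Measure (Fin d → ℝ)) [IsProbabilityMeasure ν]
    (θ : Fin d → ℝ) (σ : ℝ) : (modelLaw ν θ σ).map Prod.snd = ν := by
  have hm : Measurable fun p : (Fin d → ℝ) × ℝ => (p.1 ⬝ᵥ θ + p.2, p.1) := by
    unfold dotProduct; fun_prop
  rw [modelLaw, Measure.map_map measurable_snd hm]
  exact Measure.fst_prod

/-- The log-likelihood ratio of `(θ, σ)` against `(θ₀, σ₀)` at one observation. -/
def logRatio (θ₀ : Fin d → ℝ) (σ₀ : ℝ) (θ : Fin d → ℝ) (σ : ℝ) (z : ℝ × (Fin d → ℝ)) : ℝ :=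
  Real.log σ₀ - Real.log σ - (z.1 - z.2 ⬝ᵥ θ) ^ 2 / (2 * σ ^ 2)
    + (z.1 - z.2 ⬝ᵥ θ₀) ^ 2 / (2 * σ₀ ^ 2)

theorem measurable_logRatio (θ₀ : Fin d → ℝ) (σ₀ : ℝ) (θ : Fin d → ℝ) (σ : ℝ) :
    Measurable (logRatio θ₀ σ₀ θ σ) := by
  unfold logRatio dotProduct; fun_prop

theorem modelDensity_eq_mul_exp_logRatio (θ₀ θ : Fin d → ℝ) {σ₀ σ : ℝ} (hσ₀ : 0 < σ₀)
    (hσ : 0 < σ) (z : ℝ × (Fin d → ℝ)) :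
    modelDensity θ σ z
      = modelDensity θ₀ σ₀ z * ENNReal.ofReal (Real.exp (logRatio θ₀ σ₀ θ σ z)) := by
  have hs : ∀ s : ℝ, 0 < s → ((s ^ 2).toNNReal : ℝ) = s ^ 2 := fun s _ =>
    Real.coe_toNNReal _ (sq_nonneg s)
  unfold modelDensity gaussianPDF
  rw [← ENNReal.ofReal_mul (gaussianPDFReal_nonneg _ _ _)]
  congr 1
  rw [gaussianPDFReal, gaussianPDFReal, hs σ hσ, hs σ₀ hσ₀]
  have h1 : ∀ s : ℝ, 0 < s → (√(2 * Real.pi * s ^ 2))⁻¹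
      = (√(2 * Real.pi))⁻¹ * Real.exp (-Real.log s) := by
    intro s hs
    rw [Real.sqrt_mul (by positivity), Real.sqrt_sq hs.le, mul_inv, Real.exp_neg, Real.exp_log hs]
  rw [h1 σ hσ, h1 σ₀ hσ₀, mul_assoc, mul_assoc, mul_assoc, ← Real.exp_add, ← Real.exp_add,
    ← Real.exp_add]
  congr 2
  unfold logRatio
  ring

/-- The Hellinger-type affinity `∫ p_{θ,σ}^α p_{θ₀,σ₀}^(1-α)` as a function of `(θ, σ)`. -/
def affinity (ν : Measure (Fin d → ℝ)) (α : ℝ) (θ₀ : Fin d → ℝ) (σ₀ : ℝ)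
    (p : (Fin d → ℝ) × ℝ) : ℝ≥0∞ :=
  ∫⁻ z, modelDensity p.1 p.2 z ^ α * modelDensity θ₀ σ₀ z ^ (1 - α) ∂(volume.prod ν)

theorem measurable_affinity (ν : Measure (Fin d → ℝ)) [IsProbabilityMeasure ν] (α : ℝ)
    (θ₀ : Fin d → ℝ) (σ₀ : ℝ) : Measurable (affinity ν α θ₀ σ₀) := by
  unfold affinity
  refine Measurable.lintegral_prod_right' (f := fun q : ((Fin d → ℝ) × ℝ) × (ℝ × (Fin d → ℝ)) =>
    modelDensity q.1.1 q.1.2 q.2 ^ α * modelDensity θ₀ σ₀ q.2 ^ (1 - α)) ?_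
  exact (measurable_modelDensity_uncurry.pow_const _).mul
    (((measurable_modelDensity θ₀ σ₀).comp measurable_snd).pow_const _)

theorem lintegral_modelDensity (ν : Measure (Fin d → ℝ)) [IsProbabilityMeasure ν]
    (θ : Fin d → ℝ) {σ : ℝ} (hσ : 0 < σ) :
    ∫⁻ z, modelDensity θ σ z ∂(volume.prod ν) = 1 := by
  have := isProbabilityMeasure_modelLaw ν θ σ
  have h := measure_univ (μ := modelLaw ν θ σ)
  rwa [modelLaw_eq_withDensity ν θ σ hσ, withDensity_apply _ MeasurableSet.univ,
    Measure.restrict_univ] at h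

theorem affinity_le_one (ν : Measure (Fin d → ℝ)) [IsProbabilityMeasure ν] {α : ℝ} (h0 : 0 ≤ α)
    (h1 : α ≤ 1) (θ₀ θ : Fin d → ℝ) {σ₀ σ : ℝ} (hσ₀ : 0 < σ₀) (hσ : 0 < σ) :
    affinity ν α θ₀ σ₀ (θ, σ) ≤ 1 := by
  have h := ENNReal.lintegral_mul_norm_pow_le (μ := volume.prod ν)
    (measurable_modelDensity θ σ).aemeasurable (measurable_modelDensity θ₀ σ₀).aemeasurable
    h0 (sub_nonneg.2 h1) (by ring)
  rw [lintegral_modelDensity ν θ hσ, lintegral_modelDensity ν θ₀ hσ₀] at h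
  simpa [affinity] using h

/-- The affinity as an expectation under the true law. -/
theorem affinity_eq_lintegral_modelLaw (ν : Measure (Fin d → ℝ)) [IsProbabilityMeasure ν] {α : ℝ}
    (h0 : 0 ≤ α) (θ₀ θ : Fin d → ℝ) {σ₀ σ : ℝ} (hσ₀ : 0 < σ₀) (hσ : 0 < σ) :
    affinity ν α θ₀ σ₀ (θ, σ)
      = ∫⁻ z, ENNReal.ofReal (Real.exp (α * logRatio θ₀ σ₀ θ σ z)) ∂(modelLaw ν θ₀ σ₀) := by
  have hm : Measurable fun z : ℝ × (Fin d → ℝ) =>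
      ENNReal.ofReal (Real.exp (α * logRatio θ₀ σ₀ θ σ z)) := by
    have := measurable_logRatio θ₀ σ₀ θ σ
    fun_prop
  rw [modelLaw_eq_withDensity ν θ₀ σ₀ hσ₀, lintegral_withDensity_eq_lintegral_mul _
    (measurable_modelDensity θ₀ σ₀) hm, affinity]
  refine lintegral_congr fun z => ?_
  simp only [Pi.mul_apply]
  rw [modelDensity_eq_mul_exp_logRatio θ₀ θ hσ₀ hσ z, ENNReal.mul_rpow_of_nonneg _ _ h0,
    ENNReal.ofReal_rpow_of_pos (Real.exp_pos _), ← Real.exp_mul, mul_right_comm,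
    ← ENNReal.rpow_add _ _ (modelDensity_ne_zero θ₀ hσ₀ z) (modelDensity_ne_top θ₀ σ₀ z),
    mul_comm (logRatio θ₀ σ₀ θ σ z)]
  simp

theorem affinity_ne_zero (ν : Measure (Fin d → ℝ)) [IsProbabilityMeasure ν] {α : ℝ}
    (h0 : 0 ≤ α) (θ₀ θ : Fin d → ℝ) {σ₀ σ : ℝ} (hσ₀ : 0 < σ₀) (hσ : 0 < σ) :
    affinity ν α θ₀ σ₀ (θ, σ) ≠ 0 := by
  have := isProbabilityMeasure_modelLaw ν θ₀ σ₀
  have hm : Measurable fun z : ℝ × (Fin d → ℝ) =>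
      ENNReal.ofReal (Real.exp (α * logRatio θ₀ σ₀ θ σ z)) := by
    have := measurable_logRatio θ₀ σ₀ θ σ
    fun_prop
  rw [affinity_eq_lintegral_modelLaw ν h0 θ₀ θ hσ₀ hσ, ← pos_iff_ne_zero,
    lintegral_pos_iff_support hm]
  have : (Function.support fun z : ℝ × (Fin d → ℝ) =>
      ENNReal.ofReal (Real.exp (α * logRatio θ₀ σ₀ θ σ z))) = Set.univ := by
    ext z; simp [Real.exp_pos]
  simp [this]

/-- Minus the logarithm of the affinity, that is `(1 - α) D_α(P_{θ,σ}, P_{θ₀,σ₀})`. -/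
def negLogAffinity (ν : Measure (Fin d → ℝ)) (α : ℝ) (θ₀ : Fin d → ℝ) (σ₀ : ℝ)
    (p : (Fin d → ℝ) × ℝ) : ℝ := -Real.log (affinity ν α θ₀ σ₀ p).toReal

theorem measurable_negLogAffinity (ν : Measure (Fin d → ℝ)) [IsProbabilityMeasure ν] (α : ℝ)
    (θ₀ : Fin d → ℝ) (σ₀ : ℝ) : Measurable (negLogAffinity ν α θ₀ σ₀) :=
  ((measurable_affinity ν α θ₀ σ₀).ennreal_toReal.log).neg

theorem negLogAffinity_nonneg (ν : Measure (Fin d → ℝ)) [IsProbabilityMeasure ν] {α : ℝ}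
    (h0 : 0 ≤ α) (h1 : α ≤ 1) (θ₀ θ : Fin d → ℝ) {σ₀ σ : ℝ} (hσ₀ : 0 < σ₀) (hσ : 0 < σ) :
    0 ≤ negLogAffinity ν α θ₀ σ₀ (θ, σ) := by
  refine neg_nonneg.2 (Real.log_nonpos ENNReal.toReal_nonneg ?_)
  exact ENNReal.toReal_le_of_le_ofReal zero_le_one
    (by simpa using affinity_le_one ν h0 h1 θ₀ θ hσ₀ hσ)

theorem affinity_eq_exp_neg (ν : Measure (Fin d → ℝ)) [IsProbabilityMeasure ν] {α : ℝ}
    (h0 : 0 ≤ α) (h1 : α ≤ 1) (θ₀ θ : Fin d → ℝ) {σ₀ σ : ℝ} (hσ₀ : 0 < σ₀) (hσ : 0 < σ) :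
    affinity ν α θ₀ σ₀ (θ, σ)
      = ENNReal.ofReal (Real.exp (-negLogAffinity ν α θ₀ σ₀ (θ, σ))) := by
  have ht : affinity ν α θ₀ σ₀ (θ, σ) ≠ ∞ :=
    ne_top_of_le_ne_top ENNReal.one_ne_top (affinity_le_one ν h0 h1 θ₀ θ hσ₀ hσ)
  rw [negLogAffinity, neg_neg, Real.exp_log (ENNReal.toReal_pos
    (affinity_ne_zero ν h0 θ₀ θ hσ₀ hσ) ht), ENNReal.ofReal_toReal ht]

theorem toENNReal_renyiDiv_modelLaw (ν : Measure (Fin d → ℝ)) [IsProbabilityMeasure ν] {α : ℝ}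
    (h0 : 0 ≤ α) (h1 : α < 1) (θ₀ θ : Fin d → ℝ) {σ₀ σ : ℝ} (hσ₀ : 0 < σ₀) (hσ : 0 < σ) :
    (renyiDiv α (modelLaw ν θ σ) (modelLaw ν θ₀ σ₀)).toENNReal
      = ENNReal.ofReal (negLogAffinity ν α θ₀ σ₀ (θ, σ) / (1 - α)) := by
  have i1 := isProbabilityMeasure_modelLaw ν θ σ
  have i2 := isProbabilityMeasure_modelLaw ν θ₀ σ₀
  have h : ∫⁻ x, ((modelLaw ν θ σ).rnDeriv (modelLaw ν θ σ + modelLaw ν θ₀ σ₀) x) ^ α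
      * ((modelLaw ν θ₀ σ₀).rnDeriv (modelLaw ν θ σ + modelLaw ν θ₀ σ₀) x) ^ (1 - α)
      ∂(modelLaw ν θ σ + modelLaw ν θ₀ σ₀) = affinity ν α θ₀ σ₀ (θ, σ) := by
    rw [modelLaw_eq_withDensity ν θ σ hσ] at i1 ⊢
    rw [modelLaw_eq_withDensity ν θ₀ σ₀ hσ₀] at i2 ⊢
    exact lintegral_rnDeriv_rpow_mul_rpow _ _ _ (measurable_modelDensity θ σ)
      (measurable_modelDensity θ₀ σ₀) (modelDensity_ne_zero θ hσ) (modelDensity_ne_top θ σ)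
      (modelDensity_ne_top θ₀ σ₀) h0 h1.le
  rw [renyiDiv, h, affinity_eq_exp_neg ν h0 h1.le θ₀ θ hσ₀ hσ,
    ENNReal.log_ofReal_of_pos (Real.exp_pos _), Real.log_exp, ← EReal.coe_mul,
    EReal.real_coe_toENNReal]
  congr 1
  rw [← neg_sub 1 α, inv_neg, neg_mul_neg, div_eq_inv_mul]

/-- The affinity is at least `exp(-α KL)`, by Jensen's inequality; only a crude upper bound of the
Kullback-Leibler divergence is needed, and it requires no more than a second moment of the
design. -/
theorem negLogAffinity_le (ν : Measure (Fin d → ℝ)) [IsProbabilityMeasure ν] {α Cx R : ℝ}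
    (h0 : 0 ≤ α) (h1 : α ≤ 1)
    (hν : ∫⁻ x, ENNReal.ofReal (∑ j, x j ^ 2) ∂ν ≤ ENNReal.ofReal (Cx ^ 2))
    (θ₀ θ : Fin d → ℝ) {σ₀ σ : ℝ} (hσ₀ : 0 < σ₀) (hσ : 0 < σ)
    (hR : ∑ j, (θ j - θ₀ j) ^ 2 ≤ R) :
    negLogAffinity ν α θ₀ σ₀ (θ, σ)
      ≤ α * (max 0 (Real.log (σ / σ₀)) + (σ₀ ^ 2 + Cx ^ 2 * R) / σ ^ 2) := by
  have i2 := isProbabilityMeasure_modelLaw ν θ₀ σ₀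
  have hR0 : 0 ≤ R := (Finset.sum_nonneg fun j _ => sq_nonneg _).trans hR
  set m := max 0 (Real.log (σ / σ₀)) with hm
  have hm0 : 0 ≤ m := le_max_left _ _
  have hmeas : Measurable fun z : ℝ × (Fin d → ℝ) => z.1 - z.2 ⬝ᵥ θ := by
    unfold dotProduct; fun_prop
  have hmap : Measurable fun p : (Fin d → ℝ) × ℝ => (p.1 ⬝ᵥ θ₀ + p.2, p.1) := by
    unfold dotProduct; fun_prop
  have hgauss : ∫⁻ e, ENNReal.ofReal (e ^ 2) ∂(gaussianReal 0 (σ₀ ^ 2).toNNReal)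
      = ENNReal.ofReal (σ₀ ^ 2) := by
    have hL : MemLp (id : ℝ → ℝ) 2 (gaussianReal 0 (σ₀ ^ 2).toNNReal) := memLp_id_gaussianReal 2
    have hvar := variance_of_integral_eq_zero (μ := gaussianReal 0 (σ₀ ^ 2).toNNReal) (X := id)
      (by fun_prop) (by simp)
    rw [variance_id_gaussianReal, Real.coe_toNNReal _ (sq_nonneg σ₀)] at hvar
    refine (ofReal_integral_eq_lintegral_ofReal hL.integrable_sq
      (ae_of_all _ fun e => sq_nonneg _)).symm.trans ?_
    exact congrArg ENNReal.ofReal hvar.symm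
  have hmom : ∫⁻ z, ENNReal.ofReal ((z.1 - z.2 ⬝ᵥ θ) ^ 2) ∂(modelLaw ν θ₀ σ₀)
      ≤ ENNReal.ofReal (2 * (σ₀ ^ 2 + Cx ^ 2 * R)) := by
    rw [modelLaw, lintegral_map (by fun_prop) hmap]
    calc ∫⁻ p, ENNReal.ofReal ((p.1 ⬝ᵥ θ₀ + p.2 - p.1 ⬝ᵥ θ) ^ 2)
          ∂(ν.prod (gaussianReal 0 (σ₀ ^ 2).toNNReal))
        ≤ ∫⁻ p, (ENNReal.ofReal (2 * R) * ENNReal.ofReal (∑ j, p.1 j ^ 2)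
            + ENNReal.ofReal 2 * ENNReal.ofReal (p.2 ^ 2))
            ∂(ν.prod (gaussianReal 0 (σ₀ ^ 2).toNNReal)) := by
          refine lintegral_mono fun p => ?_
          have hs : 0 ≤ ∑ j, p.1 j ^ 2 := Finset.sum_nonneg fun j _ => sq_nonneg _
          rw [← ENNReal.ofReal_mul (by positivity), ← ENNReal.ofReal_mul (by positivity),
            ← ENNReal.ofReal_add (by positivity) (by positivity)]
          refine ENNReal.ofReal_le_ofReal ?_
          have hcs : (p.1 ⬝ᵥ (θ - θ₀)) ^ 2 ≤ (∑ j, p.1 j ^ 2) * R := by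
            refine (Finset.sum_mul_sq_le_sq_mul_sq Finset.univ p.1 (θ - θ₀)).trans ?_
            exact mul_le_mul_of_nonneg_left hR hs
          rw [dotProduct_sub] at hcs
          nlinarith [sq_nonneg (p.2 + (p.1 ⬝ᵥ θ - p.1 ⬝ᵥ θ₀))]
      _ = ENNReal.ofReal (2 * R) * ∫⁻ x, ENNReal.ofReal (∑ j, x j ^ 2) ∂ν
            + ENNReal.ofReal 2 * ENNReal.ofReal (σ₀ ^ 2) := by
          rw [lintegral_add_right _ (by fun_prop), lintegral_const_mul _ (by fun_prop),
            lintegral_const_mul _ (by fun_prop), ← hgauss]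
          congr 2
          · exact measurePreserving_fst.lintegral_comp
              (f := fun x : Fin d → ℝ => ENNReal.ofReal (∑ j, x j ^ 2)) (by fun_prop)
          · exact measurePreserving_snd.lintegral_comp
              (f := fun e : ℝ => ENNReal.ofReal (e ^ 2)) (by fun_prop)
      _ ≤ ENNReal.ofReal (2 * R) * ENNReal.ofReal (Cx ^ 2)
            + ENNReal.ofReal 2 * ENNReal.ofReal (σ₀ ^ 2) := by gcongr
      _ = _ := by
          rw [← ENNReal.ofReal_mul (by positivity), ← ENNReal.ofReal_mul (by positivity),
            ← ENNReal.ofReal_add (by positivity) (by positivity)]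
          congr 1; ring
  set w := α * (m + (σ₀ ^ 2 + Cx ^ 2 * R) / σ ^ 2) with hw
  have hw0 : 0 ≤ w := by positivity
  have hW := exp_neg_le_lintegral_exp_neg (modelLaw ν θ₀ σ₀)
    (fun z => α * (m + (z.1 - z.2 ⬝ᵥ θ) ^ 2 / (2 * σ ^ 2))) (by fun_prop)
    (fun z => by positivity) w hw0 (by
      calc ∫⁻ z, ENNReal.ofReal (α * (m + (z.1 - z.2 ⬝ᵥ θ) ^ 2 / (2 * σ ^ 2))) ∂(modelLaw ν θ₀ σ₀)
          = ∫⁻ z, (ENNReal.ofReal (α * m) + ENNReal.ofReal (α / (2 * σ ^ 2))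
              * ENNReal.ofReal ((z.1 - z.2 ⬝ᵥ θ) ^ 2)) ∂(modelLaw ν θ₀ σ₀) := by
            refine lintegral_congr fun z => ?_
            rw [← ENNReal.ofReal_mul (by positivity),
              ← ENNReal.ofReal_add (by positivity) (by positivity)]
            congr 1; ring
        _ ≤ ENNReal.ofReal (α * m) + ENNReal.ofReal (α / (2 * σ ^ 2))
              * ENNReal.ofReal (2 * (σ₀ ^ 2 + Cx ^ 2 * R)) := by
            rw [lintegral_add_left measurable_const, lintegral_const_mul _ (by fun_prop)]
            simp only [lintegral_const, measure_univ, mul_one]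
            gcongr
        _ = ENNReal.ofReal w := by
            rw [← ENNReal.ofReal_mul (by positivity),
              ← ENNReal.ofReal_add (by positivity) (by positivity)]
            congr 1; rw [hw]; field_simp)
  have hA : ENNReal.ofReal (Real.exp (-w)) ≤ affinity ν α θ₀ σ₀ (θ, σ) := by
    refine hW.trans ?_
    rw [affinity_eq_lintegral_modelLaw ν h0 θ₀ θ hσ₀ hσ]
    refine lintegral_mono fun z => ENNReal.ofReal_le_ofReal (Real.exp_le_exp.2 ?_)
    rw [← mul_neg]
    refine mul_le_mul_of_nonneg_left ?_ h0
    have hlog : Real.log σ - Real.log σ₀ ≤ m := by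
      rw [← Real.log_div hσ.ne' hσ₀.ne']; exact le_max_right _ _
    have : 0 ≤ (z.1 - z.2 ⬝ᵥ θ₀) ^ 2 / (2 * σ₀ ^ 2) := by positivity
    unfold logRatio
    linarith
  rw [affinity_eq_exp_neg ν h0 h1 θ₀ θ hσ₀ hσ] at hA
  have := Real.exp_le_exp.1 ((ENNReal.ofReal_le_ofReal_iff (Real.exp_pos _).le).1 hA)
  linarith

/-! ### The fractional posterior and its exponential moments -/

/-- The fractional likelihood ratio `(L_n(θ, σ) / L_n(θ₀, σ₀))^α` as an exponential. -/
def fracRatio (α : ℝ) (θ₀ : Fin d → ℝ) (σ₀ : ℝ) (z : Fin n → ℝ × (Fin d → ℝ))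
    (p : (Fin d → ℝ) × ℝ) : ℝ≥0∞ :=
  ENNReal.ofReal (Real.exp (α * ∑ i, logRatio θ₀ σ₀ p.1 p.2 (z i)))

theorem measurable_logRatio_uncurry (θ₀ : Fin d → ℝ) (σ₀ : ℝ) :
    Measurable fun q : ((Fin d → ℝ) × ℝ) × (ℝ × (Fin d → ℝ)) =>
      logRatio θ₀ σ₀ q.1.1 q.1.2 q.2 := by
  unfold logRatio dotProduct; fun_prop

theorem measurable_fracRatio_uncurry (α : ℝ) (θ₀ : Fin d → ℝ) (σ₀ : ℝ) :
    Measurable fun q : (Fin n → ℝ × (Fin d → ℝ)) × ((Fin d → ℝ) × ℝ) =>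
      fracRatio α θ₀ σ₀ q.1 q.2 := by
  have h : ∀ i, Measurable fun q : (Fin n → ℝ × (Fin d → ℝ)) × ((Fin d → ℝ) × ℝ) =>
      logRatio θ₀ σ₀ q.2.1 q.2.2 (q.1 i) := fun i =>
    (measurable_logRatio_uncurry θ₀ σ₀).comp
      (measurable_snd.prodMk ((measurable_pi_apply i).comp measurable_fst))
  unfold fracRatio
  fun_prop

theorem measurable_fracRatio (α : ℝ) (θ₀ : Fin d → ℝ) (σ₀ : ℝ)
    (z : Fin n → ℝ × (Fin d → ℝ)) : Measurable (fracRatio α θ₀ σ₀ z) := by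
  have h : ∀ i, Measurable fun p : (Fin d → ℝ) × ℝ => logRatio θ₀ σ₀ p.1 p.2 (z i) := fun i => by
    unfold logRatio dotProduct; fun_prop
  unfold fracRatio
  fun_prop

theorem likelihood_rpow_eq {α : ℝ} (h0 : 0 ≤ α) (θ₀ : Fin d → ℝ) {σ₀ : ℝ} (hσ₀ : 0 < σ₀)
    (z : Fin n → ℝ × (Fin d → ℝ)) (p : (Fin d → ℝ) × ℝ) (hp : 0 < p.2) :
    likelihood z p.1 p.2 ^ α = likelihood z θ₀ σ₀ ^ α * fracRatio α θ₀ σ₀ z p := by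
  have h : likelihood z p.1 p.2 = likelihood z θ₀ σ₀
      * ENNReal.ofReal (Real.exp (∑ i, logRatio θ₀ σ₀ p.1 p.2 (z i))) := by
    unfold likelihood
    rw [Real.exp_sum, ENNReal.ofReal_prod_of_nonneg fun i _ => (Real.exp_pos _).le,
      ← Finset.prod_mul_distrib]
    exact Finset.prod_congr rfl fun i _ => modelDensity_eq_mul_exp_logRatio θ₀ p.1 hσ₀ hp (z i)
  rw [h, ENNReal.mul_rpow_of_nonneg _ _ h0, ENNReal.ofReal_rpow_of_pos (Real.exp_pos _),
    ← Real.exp_mul, mul_comm _ α, fracRatio]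

theorem normalizeMeasure_smul {Ω : Type*} [MeasurableSpace Ω] (μ : Measure Ω) {c : ℝ≥0∞}
    (h0 : c ≠ 0) (ht : c ≠ ∞) : normalizeMeasure (c • μ) = normalizeMeasure μ := by
  unfold normalizeMeasure
  rw [Measure.smul_apply, smul_eq_mul, ENNReal.mul_inv (Or.inl h0) (Or.inl ht), smul_smul,
    mul_right_comm, ENNReal.inv_mul_cancel h0 ht, one_mul]

theorem fractionalPosterior_eq {α : ℝ} (h0 : 0 ≤ α) (π : Measure ((Fin d → ℝ) × ℝ))
    (hπ : ∀ᵐ p ∂π, 0 < p.2) (θ₀ : Fin d → ℝ) {σ₀ : ℝ} (hσ₀ : 0 < σ₀)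
    (z : Fin n → ℝ × (Fin d → ℝ)) :
    fractionalPosterior α π z = normalizeMeasure (π.withDensity (fracRatio α θ₀ σ₀ z)) := by
  have hne0 : likelihood z θ₀ σ₀ ≠ 0 :=
    Finset.prod_ne_zero_iff.2 fun i _ => modelDensity_ne_zero θ₀ hσ₀ (z i)
  have hnet : likelihood z θ₀ σ₀ ≠ ∞ :=
    ENNReal.prod_ne_top fun i _ => modelDensity_ne_top θ₀ σ₀ (z i)
  have h : π.withDensity (fun p => likelihood z p.1 p.2 ^ α)
      = (likelihood z θ₀ σ₀ ^ α) • π.withDensity (fracRatio α θ₀ σ₀ z) := by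
    rw [← withDensity_smul _ (measurable_fracRatio α θ₀ σ₀ z)]
    exact withDensity_congr_ae (hπ.mono fun p hp => likelihood_rpow_eq h0 θ₀ hσ₀ z p hp)
  rw [fractionalPosterior, h]
  refine normalizeMeasure_smul _ ?_ (ENNReal.rpow_ne_top_of_nonneg h0 hnet)
  exact (ENNReal.rpow_pos (pos_iff_ne_zero.2 hne0) hnet).ne'

/-- If the exponential moment of `F` weighted by the likelihood ratio is at most `exp v` and the
evidence is at least `exp (-k)`, the posterior mean of `F` is at most `v + k`. -/
theorem lintegral_fractionalPosterior_le {α : ℝ} (h0 : 0 ≤ α) (π : Measure ((Fin d → ℝ) × ℝ))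
    (hπ : ∀ᵐ p ∂π, 0 < p.2) (θ₀ : Fin d → ℝ) {σ₀ : ℝ} (hσ₀ : 0 < σ₀)
    (z : Fin n → ℝ × (Fin d → ℝ)) (F : (Fin d → ℝ) × ℝ → ℝ) (hF : Measurable F)
    (hF0 : ∀ᵐ p ∂π, 0 ≤ F p) (v k : ℝ)
    (hv : ∫⁻ p, ENNReal.ofReal (Real.exp (F p)) * fracRatio α θ₀ σ₀ z p ∂π
      ≤ ENNReal.ofReal (Real.exp v))
    (hk : ENNReal.ofReal (Real.exp (-k)) ≤ ∫⁻ p, fracRatio α θ₀ σ₀ z p ∂π) :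
    ∫⁻ p, ENNReal.ofReal (F p) ∂(fractionalPosterior α π z) ≤ ENNReal.ofReal (v + k) := by
  have hmR := measurable_fracRatio α θ₀ σ₀ z
  set Z := ∫⁻ p, fracRatio α θ₀ σ₀ z p ∂π with hZ
  have hZ0 : Z ≠ 0 := (lt_of_lt_of_le (ENNReal.ofReal_pos.2 (Real.exp_pos _)) hk).ne'
  have hZt : Z ≠ ∞ := by
    refine ne_top_of_le_ne_top ENNReal.ofReal_ne_top (le_trans ?_ hv)
    refine lintegral_mono_ae (hF0.mono fun p hp => ?_)
    calc fracRatio α θ₀ σ₀ z p = 1 * fracRatio α θ₀ σ₀ z p := (one_mul _).symm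
      _ ≤ _ := by
        gcongr
        rw [ENNReal.one_le_ofReal]
        exact Real.one_le_exp hp
  have huniv : π.withDensity (fracRatio α θ₀ σ₀ z) Set.univ = Z := by
    rw [withDensity_apply _ MeasurableSet.univ, Measure.restrict_univ]
  have hpost : fractionalPosterior α π z = Z⁻¹ • π.withDensity (fracRatio α θ₀ σ₀ z) := by
    rw [fractionalPosterior_eq h0 π hπ θ₀ hσ₀ z, normalizeMeasure, huniv]
  rw [hpost]
  have hprob : IsProbabilityMeasure (Z⁻¹ • π.withDensity (fracRatio α θ₀ σ₀ z)) := by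
    constructor
    rw [Measure.smul_apply, huniv, smul_eq_mul, ENNReal.inv_mul_cancel hZ0 hZt]
  refine lintegral_le_of_lintegral_exp_le _ F hF ?_ (v + k) ?_
  · exact (withDensity_absolutelyContinuous _ _).smul_left _ |>.ae_le hF0
  · have hme : Measurable fun p => ENNReal.ofReal (Real.exp (F p)) := by fun_prop
    rw [lintegral_smul_measure, lintegral_withDensity_eq_lintegral_mul _ hmR hme, smul_eq_mul]
    have h1 : Z⁻¹ ≤ ENNReal.ofReal (Real.exp k) := by
      rw [← neg_neg k, Real.exp_neg (-k), ENNReal.ofReal_inv_of_pos (Real.exp_pos _)]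
      exact ENNReal.inv_le_inv.2 hk
    calc Z⁻¹ * ∫⁻ p, (fracRatio α θ₀ σ₀ z * fun p => ENNReal.ofReal (Real.exp (F p))) p ∂π
        = Z⁻¹ * ∫⁻ p, ENNReal.ofReal (Real.exp (F p)) * fracRatio α θ₀ σ₀ z p ∂π := by
          congr 1
          exact lintegral_congr fun p => by rw [Pi.mul_apply, mul_comm]
      _ ≤ ENNReal.ofReal (Real.exp k) * ENNReal.ofReal (Real.exp v) := by gcongr
      _ = ENNReal.ofReal (Real.exp (v + k)) := by
          rw [← ENNReal.ofReal_mul (Real.exp_pos _).le, ← Real.exp_add, add_comm]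

/-- Under the true law, the expected likelihood ratio of a sample of size `n` is the `n`-th power of
the affinity. -/
theorem lintegral_fracRatio_pi (ν : Measure (Fin d → ℝ)) [IsProbabilityMeasure ν] {α : ℝ}
    (h0 : 0 ≤ α) (θ₀ : Fin d → ℝ) {σ₀ : ℝ} (hσ₀ : 0 < σ₀) (p : (Fin d → ℝ) × ℝ) (hp : 0 < p.2) :
    ∫⁻ z, fracRatio α θ₀ σ₀ z p ∂(Measure.pi fun _ : Fin n => modelLaw ν θ₀ σ₀)
      = affinity ν α θ₀ σ₀ p ^ n := by
  have := isProbabilityMeasure_modelLaw ν θ₀ σ₀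
  have hm := measurable_logRatio θ₀ σ₀ p.1 p.2
  have h : ∀ z : Fin n → ℝ × (Fin d → ℝ), fracRatio α θ₀ σ₀ z p
      = ∏ i, ENNReal.ofReal (Real.exp (α * logRatio θ₀ σ₀ p.1 p.2 (z i))) := by
    intro z
    rw [fracRatio, Finset.mul_sum, Real.exp_sum,
      ENNReal.ofReal_prod_of_nonneg fun i _ => (Real.exp_pos _).le]
  simp_rw [h]
  rw [lintegral_pi_prod_eq_prod (fun _ : Fin n => modelLaw ν θ₀ σ₀)
    (fun _ z => ENNReal.ofReal (Real.exp (α * logRatio θ₀ σ₀ p.1 p.2 z))) fun _ => by fun_prop]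
  rw [Finset.prod_const, Finset.card_univ, Fintype.card_fin,
    ← affinity_eq_lintegral_modelLaw ν h0 θ₀ p.1 hσ₀ hp]

theorem measure_exp_moment_gt_le (ν : Measure (Fin d → ℝ)) [IsProbabilityMeasure ν] {α : ℝ}
    (h0 : 0 ≤ α) (π : Measure ((Fin d → ℝ) × ℝ)) [SFinite π] (hπ : ∀ᵐ p ∂π, 0 < p.2)
    (θ₀ : Fin d → ℝ) {σ₀ : ℝ} (hσ₀ : 0 < σ₀) (F : (Fin d → ℝ) × ℝ → ℝ) (hF : Measurable F)
    {U δ : ℝ} (hU : 0 < U) (hδ : 0 < δ)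
    (hUF : ∫⁻ p, ENNReal.ofReal (Real.exp (F p)) * affinity ν α θ₀ σ₀ p ^ n ∂π
      ≤ ENNReal.ofReal U) :
    (Measure.pi fun _ : Fin n => modelLaw ν θ₀ σ₀)
      {z | ENNReal.ofReal (U / δ)
        < ∫⁻ p, ENNReal.ofReal (Real.exp (F p)) * fracRatio α θ₀ σ₀ z p ∂π}
      ≤ ENNReal.ofReal δ := by
  have := isProbabilityMeasure_modelLaw ν θ₀ σ₀
  set P := Measure.pi fun _ : Fin n => modelLaw ν θ₀ σ₀ with hP
  have hmeas : Measurable fun q : (Fin n → ℝ × (Fin d → ℝ)) × ((Fin d → ℝ) × ℝ) =>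
      ENNReal.ofReal (Real.exp (F q.2)) * fracRatio α θ₀ σ₀ q.1 q.2 :=
    (by fun_prop : Measurable fun q : (Fin n → ℝ × (Fin d → ℝ)) × ((Fin d → ℝ) × ℝ) =>
      ENNReal.ofReal (Real.exp (F q.2))).mul (measurable_fracRatio_uncurry α θ₀ σ₀)
  have hE : ∫⁻ z, ∫⁻ p, ENNReal.ofReal (Real.exp (F p)) * fracRatio α θ₀ σ₀ z p ∂π ∂P
      ≤ ENNReal.ofReal U := by
    rw [lintegral_lintegral_swap hmeas.aemeasurable]
    refine le_trans (le_of_eq (lintegral_congr_ae (hπ.mono fun p hp => ?_))) hUF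
    simp only
    have hm := measurable_logRatio θ₀ σ₀ p.1 p.2
    have hz : Measurable fun z : Fin n → ℝ × (Fin d → ℝ) => fracRatio α θ₀ σ₀ z p := by
      unfold fracRatio; fun_prop
    rw [lintegral_const_mul _ hz, lintegral_fracRatio_pi ν h0 θ₀ hσ₀ p hp]
  have hM := meas_ge_le_lintegral_div (μ := P) (f := fun z =>
      ∫⁻ p, ENNReal.ofReal (Real.exp (F p)) * fracRatio α θ₀ σ₀ z p ∂π)
    hmeas.lintegral_prod_right'.aemeasurable (ε := ENNReal.ofReal (U / δ))
    (ENNReal.ofReal_pos.2 (by positivity)).ne' ENNReal.ofReal_ne_top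
  refine le_trans (measure_mono ?_) (hM.trans ?_)
  · exact fun z hz => le_of_lt (Set.mem_ofPred_eq ▸ hz)
  calc _ ≤ ENNReal.ofReal U / ENNReal.ofReal (U / δ) := by gcongr
    _ = ENNReal.ofReal δ := by
        rw [← ENNReal.ofReal_div_of_pos (by positivity)]
        congr 1; field_simp

/-- Markov's inequality for the total energy of the design. -/
theorem measure_design_energy_gt_le (ν : Measure (Fin d → ℝ)) [IsProbabilityMeasure ν] {Cx η : ℝ}
    (hn : 0 < n) (hCx : 0 < Cx) (hη : 0 < η)
    (hν : ∫⁻ x, ENNReal.ofReal (∑ j, x j ^ 2) ∂ν ≤ ENNReal.ofReal (Cx ^ 2))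
    (θ₀ : Fin d → ℝ) (σ₀ : ℝ) :
    (Measure.pi fun _ : Fin n => modelLaw ν θ₀ σ₀)
      {z | 2 * n * Cx ^ 2 / η < ∑ i, ∑ j, (z i).2 j ^ 2} ≤ ENNReal.ofReal (η / 2) := by
  have := isProbabilityMeasure_modelLaw ν θ₀ σ₀
  have hnR : (0 : ℝ) < n := by exact_mod_cast hn
  set P := Measure.pi fun _ : Fin n => modelLaw ν θ₀ σ₀ with hP
  have hE : ∫⁻ z, ENNReal.ofReal (∑ i, ∑ j, (z i).2 j ^ 2) ∂P ≤ ENNReal.ofReal (n * Cx ^ 2) := by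
    calc ∫⁻ z, ENNReal.ofReal (∑ i, ∑ j, (z i).2 j ^ 2) ∂P
        = ∫⁻ z, ∑ i, ENNReal.ofReal (∑ j, (z i).2 j ^ 2) ∂P := by
          refine lintegral_congr fun z => ?_
          rw [ENNReal.ofReal_sum_of_nonneg fun i _ => Finset.sum_nonneg fun j _ => sq_nonneg _]
      _ = ∑ _i : Fin n, ∫⁻ x, ENNReal.ofReal (∑ j, x j ^ 2) ∂ν := by
          rw [lintegral_finsetSum _ fun i _ => by fun_prop]
          refine Finset.sum_congr rfl fun i _ => ?_
          rw [(measurePreserving_eval (fun _ : Fin n => modelLaw ν θ₀ σ₀) i).lintegral_comp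
            (f := fun y : ℝ × (Fin d → ℝ) => ENNReal.ofReal (∑ j, y.2 j ^ 2)) (by fun_prop)]
          conv_rhs => rw [← map_snd_modelLaw ν θ₀ σ₀]
          rw [lintegral_map (by fun_prop) measurable_snd]
      _ ≤ ∑ _i : Fin n, ENNReal.ofReal (Cx ^ 2) := Finset.sum_le_sum fun i _ => hν
      _ = ENNReal.ofReal (n * Cx ^ 2) := by simp [ENNReal.ofReal_mul hnR.le]
  have hM := meas_ge_le_lintegral_div (μ := P)
    (f := fun z => ENNReal.ofReal (∑ i, ∑ j, (z i).2 j ^ 2))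
    (Measurable.aemeasurable (by fun_prop)) (ε := ENNReal.ofReal (2 * n * Cx ^ 2 / η))
    (ENNReal.ofReal_pos.2 (by positivity)).ne' ENNReal.ofReal_ne_top
  refine le_trans (measure_mono ?_) (hM.trans ?_)
  · exact fun z hz => ENNReal.ofReal_le_ofReal (le_of_lt hz)
  calc _ ≤ ENNReal.ofReal (n * Cx ^ 2) / ENNReal.ofReal (2 * n * Cx ^ 2 / η) := by
        gcongr
    _ = ENNReal.ofReal (η / 2) := by
        rw [← ENNReal.ofReal_div_of_pos (by positivity)]
        congr 1; field_simp

/-! ### The prior -/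

theorem normalizeMeasure_univ_le_one {Ω : Type*} [MeasurableSpace Ω] (μ : Measure Ω) :
    normalizeMeasure μ Set.univ ≤ 1 := by
  rw [normalizeMeasure, Measure.smul_apply, smul_eq_mul]
  exact ENNReal.inv_mul_le_one _

theorem isFiniteMeasure_studentPrior (d : ℕ) (τ C₁ : ℝ) :
    IsFiniteMeasure (studentPrior d τ C₁) :=
  ⟨(normalizeMeasure_univ_le_one _).trans_lt ENNReal.one_lt_top⟩

theorem measurableSet_l1_ball (d : ℕ) (C₁ : ℝ) :
    MeasurableSet {θ : Fin d → ℝ | ∑ j, |θ j| ≤ C₁} :=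
  measurableSet_le (by fun_prop) measurable_const

theorem ae_studentPrior_mem_ball (d : ℕ) (τ C₁ : ℝ) :
    ∀ᵐ θ ∂(studentPrior d τ C₁), ∑ j, |θ j| ≤ C₁ := by
  have h : studentPrior d τ C₁ ≪ volume.restrict {θ : Fin d → ℝ | ∑ j, |θ j| ≤ C₁} :=
    (withDensity_absolutelyContinuous _ _).smul_left _
  exact h.ae_le (ae_restrict_mem (measurableSet_l1_ball d C₁))

/-- The factor by which the Student density at `θ₀ + ξ` may fall below the one at `ξ`: only the
nonzero coordinates of `θ₀` contribute. -/
def shiftFactor (τ : ℝ) (θ₀ : Fin d → ℝ) : ℝ :=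
  ∏ j, if θ₀ j = 0 then 1 else ((2 * (1 + θ₀ j ^ 2 / τ ^ 2)) ^ 2)⁻¹

theorem shiftFactor_pos (τ : ℝ) (θ₀ : Fin d → ℝ) : 0 < shiftFactor τ θ₀ := by
  refine Finset.prod_pos fun j _ => ?_
  split_ifs <;> positivity

theorem shiftFactor_mul_prod_le {τ : ℝ} (hτ : 0 < τ) (θ₀ ξ : Fin d → ℝ) :
    shiftFactor τ θ₀ * ∏ j, studentWeight τ (ξ j) ≤ ∏ j, studentWeight τ (θ₀ j + ξ j) := by
  rw [shiftFactor, ← Finset.prod_mul_distrib]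
  refine Finset.prod_le_prod (fun j _ => mul_nonneg (by split_ifs <;> positivity)
    (studentWeight_pos hτ _).le) fun j _ => ?_
  split_ifs with h
  · simp [h]
  · unfold studentWeight
    rw [← mul_inv, ← mul_pow]
    gcongr
    have h1 : 2 * (1 + θ₀ j ^ 2 / τ ^ 2) * (τ ^ 2 + ξ j ^ 2) - (τ ^ 2 + (θ₀ j + ξ j) ^ 2)
        = τ ^ 2 + (θ₀ j - ξ j) ^ 2 + 2 * (θ₀ j ^ 2 * ξ j ^ 2) / τ ^ 2 := by
      field_simp
      ring
    have h2 : 0 ≤ τ ^ 2 + (θ₀ j - ξ j) ^ 2 + 2 * (θ₀ j ^ 2 * ξ j ^ 2) / τ ^ 2 := by positivity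
    linarith

/-- The truncated prior dominates a multiple of the product Student law recentred at `θ₀` and
restricted to an `ℓ¹` ball. -/
theorem shiftFactor_mul_lintegral_le {τ C₁ r : ℝ} (hτ : 0 < τ) (θ₀ : Fin d → ℝ)
    (hθ₀ : ∑ j, |θ₀ j| ≤ C₁ - r) (f : (Fin d → ℝ) → ℝ≥0∞) (hf : Measurable f) :
    ENNReal.ofReal (shiftFactor τ θ₀)
        * ∫⁻ ξ, {ξ : Fin d → ℝ | ∑ j, |ξ j| ≤ r}.indicator (fun ξ => f (θ₀ + ξ)) ξ
          ∂(Measure.pi fun _ : Fin d => studentLaw τ)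
      ≤ ∫⁻ θ, f θ ∂(studentPrior d τ C₁) := by
  have hprob := isProbabilityMeasure_studentLaw hτ
  set I := ∫⁻ y, ENNReal.ofReal (studentWeight τ y) with hI
  have hI0 : I ≠ 0 := lintegral_studentWeight_ne_zero hτ
  have hIt : I ≠ ∞ := lintegral_studentWeight_ne_top hτ
  have hmw := measurable_studentWeight τ
  set w : (Fin d → ℝ) → ℝ≥0∞ := fun θ => ENNReal.ofReal (∏ j, studentWeight τ (θ j)) with hw
  have hmwd : Measurable w := by fun_prop
  have hS : Measure.pi (fun _ : Fin d => studentLaw τ)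
      = volume.withDensity fun θ => I⁻¹ ^ d * w θ := by
    have hp : IsProbabilityMeasure (volume.withDensity fun x =>
        I⁻¹ * ENNReal.ofReal (studentWeight τ x)) := hprob
    have h := pi_withDensity_eq (ι := Fin d) volume
      (fun x => I⁻¹ * ENNReal.ofReal (studentWeight τ x)) (by fun_prop)
      (fun x => mul_ne_zero (ENNReal.inv_ne_zero.2 hIt)
        (ENNReal.ofReal_pos.2 (studentWeight_pos hτ x)).ne')
      (fun x => ENNReal.mul_ne_top (ENNReal.inv_ne_top.2 hI0) ENNReal.ofReal_ne_top)
    refine h.trans ?_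
    rw [← volume_pi]
    congr 1
    funext θ
    change _ = I⁻¹ ^ d * ENNReal.ofReal (∏ j, studentWeight τ (θ j))
    rw [Finset.prod_mul_distrib, Finset.prod_const, Finset.card_univ, Fintype.card_fin,
      ENNReal.ofReal_prod_of_nonneg fun j _ => (studentWeight_pos hτ _).le]
  have hIinv : I⁻¹ ^ d * ∫⁻ θ, w θ = 1 := by
    have h := measure_univ (μ := Measure.pi fun _ : Fin d => studentLaw τ)
    rw [hS, withDensity_apply _ MeasurableSet.univ, Measure.restrict_univ,
      lintegral_const_mul _ hmwd] at h
    exact h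
  set B := {θ : Fin d → ℝ | ∑ j, |θ j| ≤ C₁} with hB
  have hBm : MeasurableSet B := measurableSet_l1_ball d C₁
  set G := {ξ : Fin d → ℝ | ∑ j, |ξ j| ≤ r} with hG
  have hGm : MeasurableSet G := measurableSet_l1_ball d r
  have hprior : studentPrior d τ C₁ = (((volume.restrict B).withDensity w) Set.univ)⁻¹
      • (volume.restrict B).withDensity w := rfl
  have hm : I⁻¹ ^ d ≤ (((volume.restrict B).withDensity w) Set.univ)⁻¹ := by
    rw [ENNReal.le_inv_iff_mul_le, withDensity_apply _ MeasurableSet.univ, Measure.restrict_univ,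
      ← hIinv]
    exact mul_le_mul' le_rfl (setLIntegral_le_lintegral _ _)
  have hmf : Measurable fun ξ => f (θ₀ + ξ) := hf.comp (measurable_const_add θ₀)
  have htr : ∫⁻ θ in B, (w * f) θ = ∫⁻ ξ, B.indicator (fun θ => (w * f) θ) (θ₀ + ξ) := by
    rw [lintegral_add_left_eq_self (fun θ => B.indicator (fun θ => (w * f) θ) θ) θ₀,
      lintegral_indicator hBm]
  rw [hprior, lintegral_smul_measure, lintegral_withDensity_eq_lintegral_mul _ hmwd hf, smul_eq_mul,
    hS, lintegral_withDensity_eq_lintegral_mul _ (hmwd.const_mul _) (hmf.indicator hGm),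
    ← lintegral_const_mul _ (((hmwd.const_mul _)).mul (hmf.indicator hGm)),
    htr]
  calc _ ≤ ∫⁻ ξ, I⁻¹ ^ d * B.indicator (fun θ => (w * f) θ) (θ₀ + ξ) := by
        refine lintegral_mono fun ξ => ?_
        simp only [Pi.mul_apply]
        by_cases hξ : ξ ∈ G
        · have hmem : θ₀ + ξ ∈ B := by
            have h1 : ∑ j, |θ₀ j + ξ j| ≤ ∑ j, |θ₀ j| + ∑ j, |ξ j| := by
              rw [← Finset.sum_add_distrib]
              exact Finset.sum_le_sum fun j _ => abs_add_le _ _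
            have h2 : ∑ j, |ξ j| ≤ r := hξ
            change ∑ j, |θ₀ j + ξ j| ≤ C₁
            linarith
          rw [Set.indicator_of_mem hξ, Set.indicator_of_mem hmem]
          have h3 : ENNReal.ofReal (shiftFactor τ θ₀) * w ξ ≤ w (θ₀ + ξ) := by
            rw [hw, ← ENNReal.ofReal_mul (shiftFactor_pos τ θ₀).le]
            exact ENNReal.ofReal_le_ofReal (shiftFactor_mul_prod_le hτ θ₀ ξ)
          calc ENNReal.ofReal (shiftFactor τ θ₀) * (I⁻¹ ^ d * w ξ * f (θ₀ + ξ))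
              = I⁻¹ ^ d * ((ENNReal.ofReal (shiftFactor τ θ₀) * w ξ) * f (θ₀ + ξ)) := by ring
            _ ≤ _ := by gcongr
        · rw [Set.indicator_of_notMem hξ]
          simp
    _ = I⁻¹ ^ d * ∫⁻ ξ, B.indicator (fun θ => (w * f) θ) (θ₀ + ξ) := by
        exact lintegral_const_mul _ (((hmwd.mul hf).indicator hBm).comp (measurable_const_add θ₀))
    _ ≤ _ := by gcongr

theorem lintegral_invGammaMeasure (a b : ℝ) (f : ℝ → ℝ≥0∞) (hf : Measurable f) :
    ∫⁻ x, f x ∂(invGammaMeasure a b) = ∫⁻ x in Set.Ioi (0 : ℝ), ENNReal.ofReal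
      (b ^ a / Real.Gamma a * x ^ (-a - 1) * Real.exp (-b / x)) * f x := by
  rw [invGammaMeasure, lintegral_withDensity_eq_lintegral_mul _ (by fun_prop) hf]
  rfl

theorem isProbabilityMeasure_invGammaMeasure {a b : ℝ} (ha : 0 < a) (hb : 0 < b) :
    IsProbabilityMeasure (invGammaMeasure a b) := by
  constructor
  have hG := Real.Gamma_pos_of_pos ha
  rw [← lintegral_one, lintegral_invGammaMeasure a b _ measurable_const]
  have h : ∀ x : ℝ, ENNReal.ofReal (b ^ a / Real.Gamma a * x ^ (-a - 1) * Real.exp (-b / x)) * 1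
      = ENNReal.ofReal (b ^ a / Real.Gamma a)
        * ENNReal.ofReal (x ^ (-a - 1) * Real.exp (-b / x)) := fun x => by
    rw [mul_one, mul_assoc, ENNReal.ofReal_mul (by positivity)]
  simp_rw [h]
  rw [lintegral_const_mul _ (by fun_prop), lintegral_rpow_mul_exp_neg_div ha hb,
    ← ENNReal.ofReal_mul (by positivity), Real.rpow_neg hb.le, ← ENNReal.ofReal_one]
  congr 1
  have : b ^ a ≠ 0 := (Real.rpow_pos_of_pos hb a).ne'
  field_simp

theorem ae_invGammaMeasure_pos (a b : ℝ) : ∀ᵐ x ∂(invGammaMeasure a b), 0 < x :=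
  (withDensity_absolutelyContinuous _ _).ae_le (ae_restrict_mem measurableSet_Ioi)

theorem ae_map_sqrt_invGammaMeasure_pos (a b : ℝ) :
    ∀ᵐ s ∂((invGammaMeasure a b).map Real.sqrt), 0 < s := by
  rw [ae_map_iff (by fun_prop) measurableSet_Ioi]
  exact (ae_invGammaMeasure_pos a b).mono fun x hx => Real.sqrt_pos.2 hx

theorem le_invGammaMeasure_Icc {a b u h : ℝ} (ha : 0 < a) (hb : 0 < b) (hu : 0 < u) (h1 : h ≤ 1) :
    ENNReal.ofReal (h * u * (b ^ a / Real.Gamma a * (2 * u) ^ (-a - 1) * Real.exp (-b / u)))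
      ≤ invGammaMeasure a b (Set.Icc u (u * (1 + h))) := by
  have hG := Real.Gamma_pos_of_pos ha
  have hsub : Set.Icc u (u * (1 + h)) ⊆ Set.Ioi 0 := fun x hx => lt_of_lt_of_le hu hx.1
  rw [invGammaMeasure, withDensity_apply _ measurableSet_Icc,
    Measure.restrict_restrict measurableSet_Icc, Set.inter_eq_left.2 hsub]
  calc _ = ∫⁻ _ in Set.Icc u (u * (1 + h)), ENNReal.ofReal
          (b ^ a / Real.Gamma a * (2 * u) ^ (-a - 1) * Real.exp (-b / u)) := by
        rw [setLIntegral_const, Real.volume_Icc, ← ENNReal.ofReal_mul (by positivity)]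
        congr 1; ring
    _ ≤ _ := by
        refine setLIntegral_mono' measurableSet_Icc fun x hx => ENNReal.ofReal_le_ofReal ?_
        have hx0 : 0 < x := hsub hx
        have h2 : (2 * u) ^ (-a - 1) ≤ x ^ (-a - 1) := by
          refine Real.rpow_le_rpow_of_nonpos hx0 (hx.2.trans ?_) (by linarith)
          nlinarith
        have h3 : Real.exp (-b / u) ≤ Real.exp (-b / x) := by
          refine Real.exp_le_exp.2 ?_
          rw [neg_div, neg_div, neg_le_neg_iff]
          exact div_le_div_of_nonneg_left hb.le hu hx.1
        gcongr

/-- Under the inverse-gamma prior on `σ²`, positive powers of `σ` of order `a` and the exponential of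
`b / (2σ²)` are simultaneously integrable. -/
theorem lintegral_exp_map_sqrt_invGammaMeasure_le {a b σ₀ : ℝ} (ha : 0 < a) (hb : 0 < b)
    (hσ₀ : 0 < σ₀) :
    ∫⁻ s, ENNReal.ofReal (Real.exp (a * max 0 (Real.log (s / σ₀)) + b / (2 * s ^ 2)))
        ∂((invGammaMeasure a b).map Real.sqrt)
      ≤ ENNReal.ofReal (2 ^ a + Real.Gamma (a / 2) / Real.Gamma a * (2 * b / σ₀ ^ 2) ^ (a / 2)) := by
  have hG := Real.Gamma_pos_of_pos ha
  have hG2 := Real.Gamma_pos_of_pos (half_pos ha)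
  have hba := Real.rpow_pos_of_pos hb a
  rw [lintegral_map (by fun_prop) (by fun_prop), lintegral_invGammaMeasure a b _ (by fun_prop)]
  have hpt : ∀ x ∈ Set.Ioi (0 : ℝ),
      ENNReal.ofReal (b ^ a / Real.Gamma a * x ^ (-a - 1) * Real.exp (-b / x))
        * ENNReal.ofReal (Real.exp (a * max 0 (Real.log (√x / σ₀)) + b / (2 * √x ^ 2)))
      ≤ ENNReal.ofReal (b ^ a / Real.Gamma a)
          * ENNReal.ofReal (x ^ (-a - 1) * Real.exp (-(b / 2) / x))
        + ENNReal.ofReal (b ^ a / Real.Gamma a * σ₀ ^ (-a))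
          * ENNReal.ofReal (x ^ (-(a / 2) - 1) * Real.exp (-(b / 2) / x)) := by
    intro x hx
    have hx0 : (0 : ℝ) < x := hx
    have hsx : 0 < √x := Real.sqrt_pos.2 hx0
    have hra := Real.rpow_pos_of_pos hx0 (-a - 1)
    have hrs := Real.rpow_pos_of_pos hσ₀ (-a)
    have hr2 := Real.rpow_pos_of_pos hx0 (-(a / 2) - 1)
    rw [← ENNReal.ofReal_mul (by positivity), ← ENNReal.ofReal_mul (by positivity),
      ← ENNReal.ofReal_mul (by positivity), ← ENNReal.ofReal_add (by positivity) (by positivity)]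
    refine ENNReal.ofReal_le_ofReal ?_
    have h1 : Real.exp (a * max 0 (Real.log (√x / σ₀))) ≤ 1 + x ^ (a / 2) * σ₀ ^ (-a) := by
      have hpos : 0 < x ^ (a / 2) * σ₀ ^ (-a) :=
        mul_pos (Real.rpow_pos_of_pos hx0 _) hrs
      rcases max_choice 0 (Real.log (√x / σ₀)) with h | h
      · rw [h]; simp; exact hpos.le
      · rw [h, mul_comm, ← Real.rpow_def_of_pos (by positivity), Real.div_rpow hsx.le hσ₀.le,
          Real.rpow_neg hσ₀.le, Real.sqrt_eq_rpow, ← Real.rpow_mul hx0.le, div_eq_mul_inv]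
        have : (1 / 2 : ℝ) * a = a / 2 := by ring
        rw [this]
        linarith
    have h2 : Real.exp (-b / x) * Real.exp (b / (2 * √x ^ 2)) = Real.exp (-(b / 2) / x) := by
      rw [← Real.exp_add, Real.sq_sqrt hx0.le]
      congr 1; field_simp; ring
    have h3 : x ^ (-a - 1) * x ^ (a / 2) = x ^ (-(a / 2) - 1) := by
      rw [← Real.rpow_add hx0]; congr 1; ring
    rw [Real.exp_add]
    calc b ^ a / Real.Gamma a * x ^ (-a - 1) * Real.exp (-b / x)
          * (Real.exp (a * max 0 (Real.log (√x / σ₀))) * Real.exp (b / (2 * √x ^ 2)))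
        = b ^ a / Real.Gamma a * x ^ (-a - 1) * Real.exp (a * max 0 (Real.log (√x / σ₀)))
          * (Real.exp (-b / x) * Real.exp (b / (2 * √x ^ 2))) := by ring
      _ ≤ b ^ a / Real.Gamma a * x ^ (-a - 1) * (1 + x ^ (a / 2) * σ₀ ^ (-a))
          * (Real.exp (-b / x) * Real.exp (b / (2 * √x ^ 2))) := by gcongr
      _ = _ := by rw [h2, ← h3]; ring
  refine (setLIntegral_mono' measurableSet_Ioi hpt).trans (le_of_eq ?_)
  rw [lintegral_add_left (by fun_prop), lintegral_const_mul _ (by fun_prop),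
    lintegral_const_mul _ (by fun_prop), lintegral_rpow_mul_exp_neg_div ha (half_pos hb),
    lintegral_rpow_mul_exp_neg_div (half_pos ha) (half_pos hb),
    ← ENNReal.ofReal_mul (by positivity), ← ENNReal.ofReal_mul (by positivity),
    ← ENNReal.ofReal_add (by positivity) (by positivity)]
  congr 1
  have e1 : (b / 2) ^ (-a) = 2 ^ a * (b ^ a)⁻¹ := by
    rw [Real.rpow_neg (by positivity), Real.div_rpow hb.le (by norm_num), inv_div, div_eq_mul_inv]
  have e2 : σ₀ ^ (-a) = ((σ₀ ^ 2) ^ (a / 2))⁻¹ := by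
    rw [Real.rpow_neg hσ₀.le, ← Real.rpow_natCast, ← Real.rpow_mul hσ₀.le]
    congr 2; push_cast; ring
  have e3 : b ^ a = b ^ (a / 2) * b ^ (a / 2) := by
    rw [← Real.rpow_add hb]; congr 1; ring
  have e4 : (b / 2) ^ (-(a / 2)) = 2 ^ (a / 2) * (b ^ (a / 2))⁻¹ := by
    rw [Real.rpow_neg (by positivity), Real.div_rpow hb.le (by norm_num), inv_div, div_eq_mul_inv]
  have e5 : (2 * b / σ₀ ^ 2) ^ (a / 2) = 2 ^ (a / 2) * b ^ (a / 2) / (σ₀ ^ 2) ^ (a / 2) := by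
    rw [Real.div_rpow (by positivity) (by positivity), Real.mul_rpow (by norm_num) hb.le]
  have hb2 := Real.rpow_pos_of_pos hb (a / 2)
  have hs2 : 0 < (σ₀ ^ 2) ^ (a / 2) := Real.rpow_pos_of_pos (by positivity) _
  rw [e1, e2, e4, e5]
  congr 1
  · field_simp
  · rw [e3]; field_simp

theorem ae_prior (d : ℕ) (τ C₁ a b : ℝ) (ha : 0 < a) (hb : 0 < b) :
    ∀ᵐ p ∂(prior d τ C₁ a b), 0 < p.2 ∧ ∑ j, |p.1 j| ≤ C₁ := by
  have := isFiniteMeasure_studentPrior d τ C₁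
  have := isProbabilityMeasure_invGammaMeasure ha hb
  have h1 := (Measure.quasiMeasurePreserving_fst (μ := studentPrior d τ C₁)
    (ν := (invGammaMeasure a b).map Real.sqrt)).ae (ae_studentPrior_mem_ball d τ C₁)
  have h2 := (Measure.quasiMeasurePreserving_snd (μ := studentPrior d τ C₁)
    (ν := (invGammaMeasure a b).map Real.sqrt)).ae (ae_map_sqrt_invGammaMeasure_pos a b)
  exact h2.and h1

/-! ### A lower bound for the evidence -/

/-- For `σ²` slightly above `m σ₀²` with `m ≥ 1`, the log-likelihood ratio at `θ₀ + ξ` is bounded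
below by a deterministic term, an even function of `ξ` and the odd function carrying the noise; the
squared noise drops out because `σ ≥ σ₀`. -/
theorem logRatio_add_ge (θ₀ ξ : Fin d → ℝ) {σ₀ σ m h : ℝ} (hσ₀ : 0 < σ₀) (hσ : 0 < σ) (hm : 1 ≤ m)
    (hh : 0 ≤ h) (h1 : m * σ₀ ^ 2 ≤ σ ^ 2) (h2 : σ ^ 2 ≤ m * σ₀ ^ 2 * (1 + h))
    (z : ℝ × (Fin d → ℝ)) :
    -(Real.log m / 2 + h / 2) - (z.2 ⬝ᵥ ξ) ^ 2 / (2 * (m * σ₀ ^ 2))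
        + (z.1 - z.2 ⬝ᵥ θ₀) * (z.2 ⬝ᵥ ξ) / σ ^ 2
      ≤ logRatio θ₀ σ₀ (θ₀ + ξ) σ z := by
  have hm0 : 0 < m := lt_of_lt_of_le one_pos hm
  have hlog : Real.log σ - Real.log σ₀ ≤ Real.log m / 2 + h / 2 := by
    have e1 : Real.log (σ ^ 2) ≤ Real.log (m * σ₀ ^ 2 * (1 + h)) :=
      Real.log_le_log (by positivity) h2
    rw [Real.log_mul (by positivity) (by positivity), Real.log_mul (by positivity) (by positivity),
      Real.log_pow, Real.log_pow] at e1
    have e2 : Real.log (1 + h) ≤ h := by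
      have := Real.log_le_sub_one_of_pos (show 0 < 1 + h by positivity)
      linarith
    push_cast at e1
    linarith
  set e := z.1 - z.2 ⬝ᵥ θ₀ with he
  set u := z.2 ⬝ᵥ ξ with hu
  have heq : z.1 - z.2 ⬝ᵥ (θ₀ + ξ) = e - u := by rw [dotProduct_add, he, hu]; ring
  have h3 : σ₀ ^ 2 ≤ σ ^ 2 := by nlinarith [sq_nonneg σ₀]
  have h4 : e ^ 2 / (2 * σ ^ 2) ≤ e ^ 2 / (2 * σ₀ ^ 2) := by gcongr
  have h5 : u ^ 2 / (2 * σ ^ 2) ≤ u ^ 2 / (2 * (m * σ₀ ^ 2)) := by gcongr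
  have h6 : (e - u) ^ 2 / (2 * σ ^ 2)
      = e ^ 2 / (2 * σ ^ 2) - e * u / σ ^ 2 + u ^ 2 / (2 * σ ^ 2) := by
    field_simp; ring
  unfold logRatio
  rw [heq, ← he, h6]
  linarith

/-- The evidence for a fixed scale `σ`. The prior is compared with a symmetric law centred at `θ₀`,
so that the noise term, being odd, may be dropped. -/
theorem le_lintegral_fracRatio_studentPrior {τ C₁ α σ₀ σ m q : ℝ} (hn : 0 < n) (hd : 0 < d)
    (hτ : 0 < τ) (h0 : 0 ≤ α) (hσ₀ : 0 < σ₀) (hσ : 0 < σ) (hm : 1 ≤ m) (hq : 0 < q)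
    (θ₀ : Fin d → ℝ) (hθ₀ : ∑ j, |θ₀ j| ≤ C₁ - 2 * d * τ)
    (h1 : m * σ₀ ^ 2 ≤ σ ^ 2) (h2 : σ ^ 2 ≤ m * σ₀ ^ 2 * (1 + 1 / n))
    (z : Fin n → ℝ × (Fin d → ℝ)) (hz : τ ^ 2 * ∑ i, ∑ j, (z i).2 j ^ 2 ≤ q) :
    ENNReal.ofReal (shiftFactor τ θ₀
        * (Real.exp (-(α * (n * Real.log m / 2 + 1 / 2 + 2 * q / (m * σ₀ ^ 2)))) * (1 / 4)))
      ≤ ∫⁻ θ, fracRatio α θ₀ σ₀ z (θ, σ) ∂(studentPrior d τ C₁) := by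
  have hprob := isProbabilityMeasure_studentLaw hτ
  have hnR : (0 : ℝ) < n := by exact_mod_cast hn
  have hm0 : 0 < m := lt_of_lt_of_le one_pos hm
  have hdm : ∀ x : Fin d → ℝ, Measurable fun ξ : Fin d → ℝ => x ⬝ᵥ ξ := fun x => by
    unfold dotProduct; fun_prop
  set S := Measure.pi fun _ : Fin d => studentLaw τ with hS
  set B := α * (n * Real.log m / 2 + 1 / 2 + 2 * q / (m * σ₀ ^ 2)) with hB
  set G := {ξ : Fin d → ℝ | ∑ j, |ξ j| ≤ 2 * d * τ ∧ ∑ i, ((z i).2 ⬝ᵥ ξ) ^ 2 ≤ 4 * q} with hG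
  set w : (Fin d → ℝ) → ℝ := fun ξ =>
    α * ∑ i, ((z i).1 - (z i).2 ⬝ᵥ θ₀) * ((z i).2 ⬝ᵥ ξ) / σ ^ 2 with hw
  have hwm : Measurable w := by have := fun i => hdm (z i).2; fun_prop
  have hGm : MeasurableSet G := by
    have hmi := fun i => hdm (z i).2
    have h : MeasurableSet {ξ : Fin d → ℝ | ∑ i, ((z i).2 ⬝ᵥ ξ) ^ 2 ≤ 4 * q} :=
      measurableSet_le (by fun_prop) measurable_const
    exact (measurableSet_l1_ball d (2 * d * τ)).inter h
  have hGS : ENNReal.ofReal (1 / 4) ≤ S G :=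
    quarter_le_pi_studentLaw hd hτ hq (fun i => (z i).2) hz
  have hsym : S G ≤ ∫⁻ ξ, G.indicator (fun ξ => ENNReal.ofReal (Real.exp (w ξ))) ξ ∂S := by
    refine lintegral_indicator_exp_odd_ge S (map_neg_pi_studentLaw hτ) G hGm ?_ w hwm ?_
    · intro ξ hξ
      refine ⟨?_, ?_⟩
      · simpa using hξ.1
      · simpa [dotProduct_neg] using hξ.2
    · intro ξ
      simp only [hw, dotProduct_neg, mul_neg, neg_div, Finset.sum_neg_distrib]
  have hfm : Measurable fun θ => fracRatio α θ₀ σ₀ z (θ, σ) := by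
    have := measurable_fracRatio α θ₀ σ₀ z
    exact this.comp measurable_prodMk_right
  refine le_trans ?_ (shiftFactor_mul_lintegral_le hτ θ₀ hθ₀ _ hfm)
  rw [ENNReal.ofReal_mul (shiftFactor_pos τ θ₀).le]
  gcongr
  calc ENNReal.ofReal (Real.exp (-B) * (1 / 4))
      = ENNReal.ofReal (Real.exp (-B)) * ENNReal.ofReal (1 / 4) :=
        ENNReal.ofReal_mul (Real.exp_pos _).le
    _ ≤ ENNReal.ofReal (Real.exp (-B))
        * ∫⁻ ξ, G.indicator (fun ξ => ENNReal.ofReal (Real.exp (w ξ))) ξ ∂S := by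
        gcongr; exact hGS.trans hsym
    _ = ∫⁻ ξ, ENNReal.ofReal (Real.exp (-B))
        * G.indicator (fun ξ => ENNReal.ofReal (Real.exp (w ξ))) ξ ∂S :=
        (lintegral_const_mul _ (Measurable.indicator (by fun_prop) hGm)).symm
    _ ≤ _ := by
        refine lintegral_mono fun ξ => ?_
        by_cases hξ : ξ ∈ G
        · have hξ' : ξ ∈ {ξ : Fin d → ℝ | ∑ j, |ξ j| ≤ 2 * d * τ} := hξ.1
          simp only [Set.indicator_of_mem hξ, Set.indicator_of_mem hξ']
          rw [fracRatio, ← ENNReal.ofReal_mul (Real.exp_pos _).le, ← Real.exp_add]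
          refine ENNReal.ofReal_le_ofReal (Real.exp_le_exp.2 ?_)
          have hsum := Finset.sum_le_sum fun i (_ : i ∈ Finset.univ) =>
            logRatio_add_ge θ₀ ξ hσ₀ hσ hm (by positivity : (0 : ℝ) ≤ 1 / n) h1 h2 (z i)
          rw [Finset.sum_add_distrib, Finset.sum_sub_distrib, Finset.sum_const, Finset.card_univ,
            Fintype.card_fin, nsmul_eq_mul, ← Finset.sum_div Finset.univ
              (fun i => ((z i).2 ⬝ᵥ ξ) ^ 2)] at hsum
          have hq4 : (∑ i, ((z i).2 ⬝ᵥ ξ) ^ 2) / (2 * (m * σ₀ ^ 2)) ≤ 2 * q / (m * σ₀ ^ 2) := by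
            rw [div_le_div_iff₀ (by positivity) (by positivity)]
            have := hξ.2
            have hp : 0 < m * σ₀ ^ 2 := by positivity
            nlinarith
          have hnn : (n : ℝ) * -(Real.log m / 2 + 1 / n / 2) = -(n * Real.log m / 2 + 1 / 2) := by
            field_simp
          rw [hnn] at hsum
          rw [hB, hw, ← mul_neg, ← mul_add]
          refine mul_le_mul_of_nonneg_left (le_trans ?_ hsum) h0
          linarith
        · rw [Set.indicator_of_notMem hξ, mul_zero]
          exact zero_le

/-- A lower bound for the evidence `∫ (L_n / L_n⁰)^α dπ`, deterministic given the energy of the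
design. -/
theorem le_lintegral_fracRatio_prior {τ C₁ a b α σ₀ m q : ℝ} (hn : 0 < n) (hd : 0 < d)
    (ha : 0 < a) (hb : 0 < b) (hτ : 0 < τ) (h0 : 0 ≤ α) (hσ₀ : 0 < σ₀) (hm : 1 ≤ m) (hq : 0 < q)
    (θ₀ : Fin d → ℝ) (hθ₀ : ∑ j, |θ₀ j| ≤ C₁ - 2 * d * τ)
    (z : Fin n → ℝ × (Fin d → ℝ)) (hz : τ ^ 2 * ∑ i, ∑ j, (z i).2 j ^ 2 ≤ q) :
    ENNReal.ofReal (shiftFactor τ θ₀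
        * (Real.exp (-(α * (n * Real.log m / 2 + 1 / 2 + 2 * q / (m * σ₀ ^ 2)))) * (1 / 4))
        * (1 / n * (m * σ₀ ^ 2) * (b ^ a / Real.Gamma a * (2 * (m * σ₀ ^ 2)) ^ (-a - 1)
          * Real.exp (-b / (m * σ₀ ^ 2)))))
      ≤ ∫⁻ p, fracRatio α θ₀ σ₀ z p ∂(prior d τ C₁ a b) := by
  have := isFiniteMeasure_studentPrior d τ C₁
  have := isProbabilityMeasure_invGammaMeasure ha hb
  have hnR : (1 : ℝ) ≤ n := by exact_mod_cast hn
  have hm0 : 0 < m := lt_of_lt_of_le one_pos hm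
  have hu : 0 < m * σ₀ ^ 2 := by positivity
  set D := shiftFactor τ θ₀
    * (Real.exp (-(α * (n * Real.log m / 2 + 1 / 2 + 2 * q / (m * σ₀ ^ 2)))) * (1 / 4)) with hD
  have hD0 : 0 ≤ D := by
    have := shiftFactor_pos τ θ₀
    positivity
  rw [ENNReal.ofReal_mul hD0, prior,
    lintegral_prod_symm' _ (measurable_fracRatio α θ₀ σ₀ z),
    lintegral_map (measurable_fracRatio α θ₀ σ₀ z).lintegral_prod_left' (by fun_prop)]
  calc _ ≤ ENNReal.ofReal D * invGammaMeasure a b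
          (Set.Icc (m * σ₀ ^ 2) (m * σ₀ ^ 2 * (1 + 1 / n))) := by
        gcongr
        exact le_invGammaMeasure_Icc ha hb hu (by rw [div_le_one (by positivity)]; exact hnR)
    _ = ∫⁻ _ in Set.Icc (m * σ₀ ^ 2) (m * σ₀ ^ 2 * (1 + 1 / n)), ENNReal.ofReal D
          ∂(invGammaMeasure a b) := by rw [setLIntegral_const]
    _ ≤ ∫⁻ x in Set.Icc (m * σ₀ ^ 2) (m * σ₀ ^ 2 * (1 + 1 / n)),
          ∫⁻ θ, fracRatio α θ₀ σ₀ z (θ, √x) ∂(studentPrior d τ C₁) ∂(invGammaMeasure a b) := by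
        refine setLIntegral_mono' measurableSet_Icc fun x hx => ?_
        have hx0 : 0 < x := lt_of_lt_of_le hu hx.1
        exact le_lintegral_fracRatio_studentPrior hn hd hτ h0 hσ₀ (Real.sqrt_pos.2 hx0) hm hq θ₀ hθ₀
          (by rw [Real.sq_sqrt hx0.le]; exact hx.1) (by rw [Real.sq_sqrt hx0.le]; exact hx.2) z hz
    _ ≤ _ := setLIntegral_le_lintegral _ _

/-! ### Numerical bounds -/

theorem half_lt_log_two : (1 / 2 : ℝ) < Real.log 2 := by
  have := Real.log_two_gt_d9; linarith

/-- `log (2d)` is at most a multiple of `s log (x)` as soon as `x ≥ 2d / s` and `s ≤ d`. -/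
theorem log_two_mul_le {s d : ℕ} {x : ℝ} (hs : 1 ≤ s) (hsd : s ≤ d) (hx : 2 * d / s ≤ x) :
    Real.log 2 ≤ Real.log x ∧ Real.log (2 * d) ≤ 2 * (s * Real.log x) := by
  have hsR : (1 : ℝ) ≤ s := by exact_mod_cast hs
  have hsdR : (s : ℝ) ≤ d := by exact_mod_cast hsd
  have hs0 : (0 : ℝ) < s := by linarith
  have hd0 : (0 : ℝ) < d := by linarith
  have h2 : (2 : ℝ) ≤ 2 * d / s := by rw [le_div_iff₀ hs0]; linarith
  have hL : Real.log 2 ≤ Real.log x := Real.log_le_log (by norm_num) (h2.trans hx)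
  refine ⟨hL, ?_⟩
  have hlog2 := Real.log_two_gt_d9
  have h3 : Real.log (2 * d) = Real.log (2 * d / s) + Real.log s := by
    rw [Real.log_div (by positivity) (by positivity)]; ring
  have h4 : Real.log (2 * d / s) ≤ Real.log x := Real.log_le_log (by positivity) hx
  have h5 : Real.log s ≤ s - 1 := Real.log_le_sub_one_of_pos hs0
  nlinarith

theorem sum_ite_eq_zero_sparsity (θ₀ : Fin d → ℝ) (y : ℝ) :
    ∑ j, (if θ₀ j = 0 then 0 else y) = sparsity θ₀ * y := by
  rw [sparsity, ← Finset.sum_filter_add_sum_filter_not Finset.univ (fun j => θ₀ j = 0)]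
  rw [Finset.sum_congr rfl (g := fun _ => (0 : ℝ)) (fun j hj => by simp [(Finset.mem_filter.1 hj).2]),
    Finset.sum_congr rfl (g := fun _ => y) (s₁ := Finset.univ.filter fun j => ¬θ₀ j = 0)
      (fun j hj => by simp [(Finset.mem_filter.1 hj).2])]
  simp

/-- The price of recentring the prior at `θ₀`: by concavity of the logarithm it is at most a multiple
of `s log (C₁ / (s τ))`. -/
theorem exp_le_shiftFactor {τ C₁ : ℝ} (hτ : 0 < τ) (θ₀ : Fin d → ℝ) (hs : 1 ≤ sparsity θ₀)
    (hθ₀ : ∑ j, |θ₀ j| ≤ C₁) (hx : 2 ≤ C₁ / (τ * sparsity θ₀)) :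
    Real.exp (-(10 * (sparsity θ₀ * Real.log (C₁ / (τ * sparsity θ₀))))) ≤ shiftFactor τ θ₀ := by
  set s := sparsity θ₀ with hsdef
  set x := C₁ / (τ * s) with hxdef
  have hsR : (1 : ℝ) ≤ s := by exact_mod_cast hs
  have hs0 : (0 : ℝ) < s := by linarith
  have hx0 : 0 < x := by linarith
  have hL : Real.log 2 ≤ Real.log x := Real.log_le_log (by norm_num) hx
  have ht : Real.log (1 + x) ≤ 2 * Real.log x := by
    rw [← Real.log_rpow hx0]
    refine Real.log_le_log (by positivity) ?_
    have h : x ^ (2 : ℝ) = x ^ 2 := by norm_cast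
    rw [h]
    nlinarith
  have hexp : shiftFactor τ θ₀ = Real.exp (-∑ j, if θ₀ j = 0 then 0 else
      2 * Real.log (2 * (1 + θ₀ j ^ 2 / τ ^ 2))) := by
    rw [← Finset.sum_neg_distrib, Real.exp_sum]
    refine Finset.prod_congr rfl fun j _ => ?_
    split_ifs with h
    · simp
    · rw [Real.exp_neg, two_mul (Real.log _), Real.exp_add, Real.exp_log (by positivity), sq]
  rw [hexp]
  refine Real.exp_le_exp.2 (neg_le_neg ?_)
  have hterm : ∀ j, (if θ₀ j = 0 then 0 else 2 * Real.log (2 * (1 + θ₀ j ^ 2 / τ ^ 2)))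
      ≤ (if θ₀ j = 0 then 0 else 2 * Real.log 2 + 4 * Real.log (1 + x) + 4 / (1 + x) - 4)
        + 4 / ((1 + x) * τ) * |θ₀ j| := by
    intro j
    split_ifs with h
    · simp [h]
    · have e1 : Real.log (2 * (1 + θ₀ j ^ 2 / τ ^ 2))
          ≤ Real.log 2 + 2 * Real.log (1 + |θ₀ j| / τ) := by
        rw [Real.log_mul (by norm_num) (by positivity)]
        have : 2 * Real.log (1 + |θ₀ j| / τ) = Real.log ((1 + |θ₀ j| / τ) ^ 2) := by
          rw [Real.log_pow]; norm_num
        rw [this]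
        gcongr
        have h1 : θ₀ j ^ 2 / τ ^ 2 = (|θ₀ j| / τ) ^ 2 := by rw [div_pow, sq_abs]
        rw [h1]
        have : 0 ≤ |θ₀ j| / τ := by positivity
        nlinarith
      -- the tangent of the logarithm at `1 + x`
      have e2 : Real.log (1 + |θ₀ j| / τ) ≤ Real.log (1 + x) + (1 + |θ₀ j| / τ) / (1 + x) - 1 := by
        have := Real.log_le_sub_one_of_pos
          (show 0 < (1 + |θ₀ j| / τ) / (1 + x) by positivity)
        rw [Real.log_div (by positivity) (by positivity)] at this
        linarith
      have e3 : (1 + |θ₀ j| / τ) / (1 + x) = 1 / (1 + x) + 1 / ((1 + x) * τ) * |θ₀ j| := by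
        field_simp
      rw [e3] at e2
      have e4 : 4 / (1 + x) = 4 * (1 / (1 + x)) := by ring
      have e5 : 4 / ((1 + x) * τ) * |θ₀ j| = 4 * (1 / ((1 + x) * τ) * |θ₀ j|) := by ring
      rw [e4, e5]
      linarith
  refine (Finset.sum_le_sum fun j _ => hterm j).trans ?_
  rw [Finset.sum_add_distrib, sum_ite_eq_zero_sparsity, ← Finset.mul_sum, ← hsdef]
  have h6 : 4 / ((1 + x) * τ) * ∑ j, |θ₀ j| ≤ 4 / ((1 + x) * τ) * C₁ := by gcongr
  have h7 : 4 / ((1 + x) * τ) * C₁ = s * (4 * x / (1 + x)) := by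
    rw [hxdef]; field_simp
  have h8 : (s : ℝ) * (4 / (1 + x)) + s * (4 * x / (1 + x)) = s * 4 := by
    field_simp
  nlinarith

/-- The prior mass of the window of variances, in exponential form. -/
theorem exp_le_window {a b κ σmin σmax σ₀ m : ℝ} {n : ℕ} (ha : 0 < a)
    (hσmax : 0 < σmax) (hσ₀ : 0 < σ₀) (h1 : (σ₀ ^ 2)⁻¹ ≤ 2 * σmin)
    (h2 : 2 * σmax ≤ (σ₀ ^ 2)⁻¹) (hn : 0 < n) (hm : 1 ≤ m) (hbn : (n : ℝ) ^ (-κ) ≤ b)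
    (hbκ : b ≤ κ) :
    Real.exp (-(|Real.log ((Real.Gamma a)⁻¹ * 2 ^ (-a - 1) * (2 * σmax) ^ a
        * Real.exp (-(2 * κ * σmin)))| + (1 + κ * a) * Real.log n + a * Real.log m))
      ≤ 1 / n * (m * σ₀ ^ 2) * (b ^ a / Real.Gamma a * (2 * (m * σ₀ ^ 2)) ^ (-a - 1)
          * Real.exp (-b / (m * σ₀ ^ 2))) := by
  have hG := Real.Gamma_pos_of_pos ha
  have hnR : (0 : ℝ) < n := by exact_mod_cast hn
  have hm0 : 0 < m := lt_of_lt_of_le one_pos hm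
  have hnκ : 0 < (n : ℝ) ^ (-κ) := Real.rpow_pos_of_pos hnR _
  have hb : 0 < b := lt_of_lt_of_le hnκ hbn
  set C := (Real.Gamma a)⁻¹ * 2 ^ (-a - 1) * (2 * σmax) ^ a * Real.exp (-(2 * κ * σmin)) with hC
  have h2a : (0 : ℝ) < 2 ^ (-a - 1) := Real.rpow_pos_of_pos (by norm_num) _
  have hsa : (0 : ℝ) < (2 * σmax) ^ a := Real.rpow_pos_of_pos (by positivity) _
  have hC0 : 0 < C := by positivity
  have hma : 0 < m ^ (-a) := Real.rpow_pos_of_pos hm0 _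
  have hL : Real.exp (-(|Real.log C| + (1 + κ * a) * Real.log n + a * Real.log m))
      ≤ C * ((n : ℝ)⁻¹ * ((n : ℝ) ^ (-κ)) ^ a * m ^ (-a)) := by
    have e1 : C * ((n : ℝ)⁻¹ * ((n : ℝ) ^ (-κ)) ^ a * m ^ (-a))
        = Real.exp (Real.log C - (1 + κ * a) * Real.log n - a * Real.log m) := by
      rw [← Real.rpow_mul hnR.le, Real.rpow_def_of_pos hnR, Real.rpow_def_of_pos hm0,
        ← Real.exp_log hC0, Real.log_exp]
      nth_rewrite 1 [← Real.exp_log hnR]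
      rw [← Real.exp_neg, ← Real.exp_add, ← Real.exp_add, ← Real.exp_add]
      congr 1; ring
    rw [e1]
    refine Real.exp_le_exp.2 ?_
    have := neg_abs_le (Real.log C)
    linarith
  refine hL.trans ?_
  have hs2 : 0 < σ₀ ^ 2 := by positivity
  have e2 : (m * σ₀ ^ 2) * (2 * (m * σ₀ ^ 2)) ^ (-a - 1)
      = 2 ^ (-a - 1) * (m ^ (-a) * ((σ₀ ^ 2)⁻¹) ^ a) := by
    have hu : 0 < m * σ₀ ^ 2 := by positivity
    rw [Real.mul_rpow (by norm_num) hu.le, Real.inv_rpow hs2.le, ← Real.rpow_neg hs2.le,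
      ← Real.mul_rpow hm0.le hs2.le, Real.rpow_sub_one hu.ne']
    field_simp
  have e3 : (2 * σmax) ^ a ≤ ((σ₀ ^ 2)⁻¹) ^ a := Real.rpow_le_rpow (by positivity) h2 ha.le
  have e4 : ((n : ℝ) ^ (-κ)) ^ a ≤ b ^ a := Real.rpow_le_rpow hnκ.le hbn ha.le
  have e5 : Real.exp (-(2 * κ * σmin)) ≤ Real.exp (-b / (m * σ₀ ^ 2)) := by
    refine Real.exp_le_exp.2 ?_
    rw [neg_div, neg_le_neg_iff]
    calc b / (m * σ₀ ^ 2) ≤ b / σ₀ ^ 2 := by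
          gcongr; nlinarith
      _ = b * (σ₀ ^ 2)⁻¹ := div_eq_mul_inv _ _
      _ ≤ κ * (2 * σmin) := mul_le_mul hbκ h1 (by positivity) (hb.le.trans hbκ)
      _ = 2 * κ * σmin := by ring
  calc C * ((n : ℝ)⁻¹ * ((n : ℝ) ^ (-κ)) ^ a * m ^ (-a))
      = (Real.Gamma a)⁻¹ * (n : ℝ)⁻¹ * 2 ^ (-a - 1) * m ^ (-a)
        * ((2 * σmax) ^ a * ((n : ℝ) ^ (-κ)) ^ a * Real.exp (-(2 * κ * σmin))) := by
        rw [hC]; ring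
    _ ≤ (Real.Gamma a)⁻¹ * (n : ℝ)⁻¹ * 2 ^ (-a - 1) * m ^ (-a)
        * (((σ₀ ^ 2)⁻¹) ^ a * b ^ a * Real.exp (-b / (m * σ₀ ^ 2))) := by
        gcongr
    _ = (Real.Gamma a)⁻¹ * (n : ℝ)⁻¹ * (2 ^ (-a - 1) * (m ^ (-a) * ((σ₀ ^ 2)⁻¹) ^ a)) * b ^ a
        * Real.exp (-b / (m * σ₀ ^ 2)) := by ring
    _ = _ := by rw [← e2]; ring

/-- The misfit of the inflated variance `m σ₀²`, `m = max 1 (N / d)`: both the inflation itself and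
the energy `N² / d` of a heavy-tailed design cost a multiple of `N`. -/
theorem misfit_le {n d : ℕ} {N α σmin σ₀ : ℝ} (hnd : n ≤ d) (hd : 0 < d) (hN : 1 ≤ N)
    (h0 : 0 ≤ α) (hσ₀ : 0 < σ₀) (h1 : (σ₀ ^ 2)⁻¹ ≤ 2 * σmin) :
    α * (n * Real.log (max 1 (N / d)) / 2 + 1 / 2 + 2 * (2 * N ^ 2 / d) / (max 1 (N / d) * σ₀ ^ 2))
      ≤ (1 + 8 * σmin) * (α * N) := by
  have hdR : (0 : ℝ) < d := by exact_mod_cast hd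
  have hndR : (n : ℝ) ≤ d := by exact_mod_cast hnd
  set m := max 1 (N / d) with hm
  have hm1 : 1 ≤ m := le_max_left _ _
  have hm2 : N ≤ m * d := by rw [← div_le_iff₀ hdR]; exact le_max_right _ _
  have hlog : n * Real.log m ≤ N := by
    rcases max_choice 1 (N / d) with h | h
    · rw [hm, h, Real.log_one, mul_zero]; linarith
    · have hNd : 0 < N / d := by positivity
      have h2 : Real.log m ≤ N / d := by
        rw [hm, h]; have := Real.log_le_sub_one_of_pos hNd; linarith
      calc n * Real.log m ≤ d * (N / d) :=
            mul_le_mul hndR h2 (Real.log_nonneg hm1) hdR.le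
        _ = N := by field_simp
  have hE : 2 * (2 * N ^ 2 / d) / (m * σ₀ ^ 2) ≤ 8 * σmin * N := by
    calc 2 * (2 * N ^ 2 / d) / (m * σ₀ ^ 2) = 4 * N * (N / (m * d)) * (σ₀ ^ 2)⁻¹ := by
          have : 0 < m := by linarith
          field_simp; ring
      _ ≤ 4 * N * 1 * (2 * σmin) := by
          have : N / (m * d) ≤ 1 := by rw [div_le_one (by positivity)]; exact hm2
          gcongr
      _ = 8 * σmin * N := by ring
  calc _ ≤ α * (N / 2 + N / 2 + 8 * σmin * N) := by gcongr
    _ = _ := by ring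

/-- When `α N` and the complexity are at most `log N / K`, every polynomial factor is negligible
against `1 / N`. -/
theorem small_fraction {n : ℕ} {K ℓ α κ V D x : ℝ} (hK : 2 * (8 + 2 * κ) ≤ K) (hK0 : 0 < K)
    (hκ : 0 ≤ κ) (hℓ : 0 ≤ ℓ) (h0 : 0 ≤ α) (hα : α * Real.exp ℓ ≤ ℓ / K) (hn : 0 < n)
    (hnℓ : (n : ℝ) ≤ Real.exp (2 * ℓ / K)) (hD : 0 ≤ D) (hV : V ≤ D * x ^ 2) (hx0 : 0 ≤ x)
    (hx : x ≤ Real.exp (3 * ℓ / K)) :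
    ℓ * n * α * V * (n : ℝ) ^ κ ≤ 8 * D / K := by
  have hnR : (0 : ℝ) < n := by exact_mod_cast hn
  have hα' : α ≤ ℓ / K * Real.exp (-ℓ) := by
    rw [Real.exp_neg, ← div_eq_mul_inv, le_div_iff₀ (Real.exp_pos _)]; exact hα
  have hnκ : (n : ℝ) ^ κ ≤ Real.exp (2 * ℓ / K * κ) := by
    rw [Real.exp_mul]; exact Real.rpow_le_rpow hnR.le hnℓ hκ
  have hx2 : x ^ 2 ≤ Real.exp (3 * ℓ / K) * Real.exp (3 * ℓ / K) := by
    rw [sq]; exact mul_le_mul hx hx hx0 (Real.exp_pos _).le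
  have hV' : V ≤ D * (Real.exp (3 * ℓ / K) * Real.exp (3 * ℓ / K)) :=
    hV.trans (mul_le_mul_of_nonneg_left hx2 hD)
  have hpow : Real.exp (2 * ℓ / K) * (Real.exp (3 * ℓ / K) * Real.exp (3 * ℓ / K))
      * Real.exp (2 * ℓ / K * κ) * Real.exp (-ℓ) ≤ Real.exp (-(ℓ / 2)) := by
    rw [← Real.exp_add, ← Real.exp_add, ← Real.exp_add, ← Real.exp_add]
    refine Real.exp_le_exp.2 ?_
    have h1 : 2 * ℓ / K + (3 * ℓ / K + 3 * ℓ / K) + 2 * ℓ / K * κ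
        = (8 + 2 * κ) * ℓ / K := by ring
    have h2 : (8 + 2 * κ) * ℓ / K ≤ ℓ / 2 := by
      rw [div_le_div_iff₀ hK0 (by norm_num)]
      nlinarith
    linarith
  have hsq : ℓ ^ 2 * Real.exp (-(ℓ / 2)) ≤ 8 := by
    rw [Real.exp_neg, ← div_eq_mul_inv, div_le_iff₀ (Real.exp_pos _)]
    have := Real.quadratic_le_exp_of_nonneg (show 0 ≤ ℓ / 2 by linarith)
    nlinarith
  have hDE : 0 ≤ D * (Real.exp (3 * ℓ / K) * Real.exp (3 * ℓ / K)) := by positivity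
  calc ℓ * n * α * V * (n : ℝ) ^ κ
      ≤ ℓ * n * α * (D * (Real.exp (3 * ℓ / K) * Real.exp (3 * ℓ / K))) * (n : ℝ) ^ κ := by
        gcongr
    _ ≤ ℓ * Real.exp (2 * ℓ / K) * (ℓ / K * Real.exp (-ℓ))
          * (D * (Real.exp (3 * ℓ / K) * Real.exp (3 * ℓ / K))) * Real.exp (2 * ℓ / K * κ) := by
        gcongr
    _ = D / K * (ℓ ^ 2 * (Real.exp (2 * ℓ / K) * (Real.exp (3 * ℓ / K) * Real.exp (3 * ℓ / K))
          * Real.exp (2 * ℓ / K * κ) * Real.exp (-ℓ))) := by ring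
    _ ≤ D / K * (ℓ ^ 2 * Real.exp (-(ℓ / 2))) := by gcongr
    _ ≤ D / K * 8 := by gcongr
    _ = 8 * D / K := by ring

/-! ### Concentration of the fractional posterior -/

theorem fractionalPosterior_absolutelyContinuous (α : ℝ) (π : Measure ((Fin d → ℝ) × ℝ))
    (z : Fin n → ℝ × (Fin d → ℝ)) : fractionalPosterior α π z ≪ π :=
  (withDensity_absolutelyContinuous _ _).smul_left _

theorem lintegral_renyiDiv_le (ν : Measure (Fin d → ℝ)) [IsProbabilityMeasure ν] {α : ℝ}
    (h0 : 0 ≤ α) (h1 : α < 1) (θ₀ : Fin d → ℝ) {σ₀ : ℝ} (hσ₀ : 0 < σ₀)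
    (Q : Measure ((Fin d → ℝ) × ℝ)) (hQ : ∀ᵐ p ∂Q, 0 < p.2) {l t : ℝ} (hl : 0 < l)
    (h : ∫⁻ p, ENNReal.ofReal (l * negLogAffinity ν α θ₀ σ₀ p) ∂Q ≤ ENNReal.ofReal t) :
    ∫⁻ p, (renyiDiv α (modelLaw ν p.1 p.2) (modelLaw ν θ₀ σ₀)).toENNReal ∂Q
      ≤ ENNReal.ofReal (t / (l * (1 - α))) := by
  have hα : 0 < 1 - α := sub_pos.2 h1
  have hm := measurable_negLogAffinity ν α θ₀ σ₀
  calc _ = ∫⁻ p, ENNReal.ofReal (1 / (l * (1 - α)))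
          * ENNReal.ofReal (l * negLogAffinity ν α θ₀ σ₀ p) ∂Q := by
        refine lintegral_congr_ae (hQ.mono fun p hp => ?_)
        simp only
        rw [toENNReal_renyiDiv_modelLaw ν h0 h1 θ₀ p.1 hσ₀ hp, ← ENNReal.ofReal_mul (by positivity)]
        congr 1
        field_simp
    _ = ENNReal.ofReal (1 / (l * (1 - α)))
          * ∫⁻ p, ENNReal.ofReal (l * negLogAffinity ν α θ₀ σ₀ p) ∂Q :=
        lintegral_const_mul _ (by fun_prop)
    _ ≤ ENNReal.ofReal (1 / (l * (1 - α))) * ENNReal.ofReal t := by gcongr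
    _ = _ := by
        rw [← ENNReal.ofReal_mul (by positivity)]
        congr 1; ring

theorem ofReal_one_sub_sub_le {Ω : Type*} [MeasurableSpace Ω] (P : Measure Ω)
    [IsProbabilityMeasure P] {T E₁ E₂ : Set Ω} {e₁ e₂ : ℝ} (h1 : 0 ≤ e₁) (h2 : 0 ≤ e₂)
    (hE₁ : P E₁ ≤ ENNReal.ofReal e₁) (hE₂ : P E₂ ≤ ENNReal.ofReal e₂)
    (hT : ∀ ω, ω ∉ E₁ → ω ∉ E₂ → ω ∈ T) : ENNReal.ofReal (1 - e₁ - e₂) ≤ P T := by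
  have hcover : (Set.univ : Set Ω) ⊆ T ∪ (E₁ ∪ E₂) := by
    intro ω _
    by_cases h1 : ω ∈ E₁
    · exact Or.inr (Or.inl h1)
    by_cases h2 : ω ∈ E₂
    · exact Or.inr (Or.inr h2)
    exact Or.inl (hT ω h1 h2)
  rw [sub_sub, ENNReal.ofReal_sub _ (by positivity), ENNReal.ofReal_one, tsub_le_iff_right,
    ENNReal.ofReal_add h1 h2]
  calc (1 : ℝ≥0∞) = P Set.univ := measure_univ.symm
    _ ≤ P T + (P E₁ + P E₂) := (measure_mono hcover).trans ((measure_union_le _ _).trans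
        (add_le_add le_rfl (measure_union_le _ _)))
    _ ≤ _ := by gcongr

/-- Concentration from an exponential moment: a function `F` dominating `l` times
`(1 - α) D_α`, whose exponential moment against the affinity is at most `U`, and a lower bound of the
evidence valid on the event of moderate design energy. -/
theorem le_measure_lintegral_renyiDiv_le (ν : Measure (Fin d → ℝ)) [IsProbabilityMeasure ν]
    {α Cx η : ℝ} (h0 : 0 ≤ α) (h1 : α < 1) (hn : 0 < n) (hCx : 0 < Cx) (hη : 0 < η)
    (hν : ∫⁻ x, ENNReal.ofReal (∑ j, x j ^ 2) ∂ν ≤ ENNReal.ofReal (Cx ^ 2))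
    (π : Measure ((Fin d → ℝ) × ℝ)) [SFinite π] (hπ : ∀ᵐ p ∂π, 0 < p.2)
    (θ₀ : Fin d → ℝ) {σ₀ : ℝ} (hσ₀ : 0 < σ₀) (F : (Fin d → ℝ) × ℝ → ℝ) (hF : Measurable F)
    {l U δ k : ℝ} (hl : 0 < l) (hU : 0 < U) (hδ : 0 < δ)
    (hlF : ∀ᵐ p ∂π, l * negLogAffinity ν α θ₀ σ₀ p ≤ F p)
    (hUF : ∫⁻ p, ENNReal.ofReal (Real.exp (F p)) * affinity ν α θ₀ σ₀ p ^ n ∂π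
      ≤ ENNReal.ofReal U)
    (hk : ∀ z : Fin n → ℝ × (Fin d → ℝ), ∑ i, ∑ j, (z i).2 j ^ 2 ≤ 2 * n * Cx ^ 2 / η →
      ENNReal.ofReal (Real.exp (-k)) ≤ ∫⁻ p, fracRatio α θ₀ σ₀ z p ∂π) :
    ENNReal.ofReal (1 - δ - η / 2) ≤
      (Measure.pi fun _ : Fin n => modelLaw ν θ₀ σ₀)
        {z | ∫⁻ p, (renyiDiv α (modelLaw ν p.1 p.2) (modelLaw ν θ₀ σ₀)).toENNReal
              ∂(fractionalPosterior α π z)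
            ≤ ENNReal.ofReal ((Real.log (U / δ) + k) / (l * (1 - α)))} := by
  have := isProbabilityMeasure_modelLaw ν θ₀ σ₀
  refine ofReal_one_sub_sub_le _ hδ.le (by positivity)
    (measure_exp_moment_gt_le ν h0 π hπ θ₀ hσ₀ F hF hU hδ hUF)
    (measure_design_energy_gt_le ν hn hCx hη hν θ₀ σ₀) fun z hz1 hz2 => ?_
  have hac := fractionalPosterior_absolutelyContinuous α π z
  refine lintegral_renyiDiv_le ν h0 h1 θ₀ hσ₀ _ (hac.ae_le hπ) hl ?_
  have hF0 : ∀ᵐ p ∂π, 0 ≤ F p := by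
    filter_upwards [hlF, hπ] with p hp1 hp2
    exact (mul_nonneg hl.le (negLogAffinity_nonneg ν h0 h1.le θ₀ p.1 hσ₀ hp2)).trans hp1
  have hlF' : ∀ᵐ p ∂(fractionalPosterior α π z), l * negLogAffinity ν α θ₀ σ₀ p ≤ F p :=
    hac.ae_le hlF
  refine (lintegral_mono_ae (hlF'.mono fun p hp => ENNReal.ofReal_le_ofReal hp)).trans ?_
  refine lintegral_fractionalPosterior_le h0 π hπ θ₀ hσ₀ z F hF hF0 _ _ ?_ (hk z (not_lt.1 hz2))
  rw [Real.exp_log (by positivity)]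
  exact not_lt.1 hz1

/-- The constant term of the logarithm of the prior mass of a window of variances. -/
def windowConst (σmin σmax a κ : ℝ) : ℝ :=
  |Real.log ((Real.Gamma a)⁻¹ * 2 ^ (-a - 1) * (2 * σmax) ^ a * Real.exp (-(2 * κ * σmin)))|

/-- The lower bound of the evidence in terms of the complexity `s log (Cx C₁ √(nd) / s)`, with
`N = η^(-1/2)`. -/
theorem exp_le_lintegral_fracRatio_prior {σmin σmax a κ α Cx C₁ b τ η N σ₀ : ℝ} (hσmax : 0 < σmax)
    (ha : 0 < a) (h0 : 0 ≤ α) (hCx : 0 < Cx) (hη : 0 < η) (hN : 1 ≤ N) (hNη : N ^ 2 = 1 / η)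
    (hσ₀ : 0 < σ₀) (hs1 : (σ₀ ^ 2)⁻¹ ≤ 2 * σmin) (hs2 : 2 * σmax ≤ (σ₀ ^ 2)⁻¹)
    (hbn : (n : ℝ) ^ (-κ) ≤ b) (hbκ : b ≤ κ) (hτ : τ = 1 / (Cx * √((n : ℝ) * d)))
    (hn : 0 < n) (hnd : n < d) (θ₀ : Fin d → ℝ) (hs : 1 ≤ sparsity θ₀) (hsn : sparsity θ₀ < n)
    (hθ₀ : ∑ j, |θ₀ j| ≤ C₁ - 2 * d * τ) (z : Fin n → ℝ × (Fin d → ℝ))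
    (hz : ∑ i, ∑ j, (z i).2 j ^ 2 ≤ 2 * n * Cx ^ 2 / η) :
    ENNReal.ofReal (Real.exp (-((12 + 2 * windowConst σmin σmax a κ + 2 * (1 + κ * a))
        * (sparsity θ₀ * Real.log (Cx * C₁ * √((n : ℝ) * d) / sparsity θ₀))
        + a * Real.log (max 1 (N / d)) + (1 + 8 * σmin) * (α * N))))
      ≤ ∫⁻ p, fracRatio α θ₀ σ₀ z p ∂(prior d τ C₁ a b) := by
  have hnR : (0 : ℝ) < n := by exact_mod_cast hn
  have hd : 0 < d := by omega
  have hdR : (0 : ℝ) < d := by exact_mod_cast hd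
  have hsR : (1 : ℝ) ≤ sparsity θ₀ := by exact_mod_cast hs
  have hnκ : 0 < (n : ℝ) ^ (-κ) := Real.rpow_pos_of_pos hnR _
  have hb : 0 < b := lt_of_lt_of_le hnκ hbn
  have hκ : 0 < κ := lt_of_lt_of_le hb hbκ
  have hτ0 : 0 < τ := by rw [hτ]; positivity
  have hxeq : Cx * C₁ * √((n : ℝ) * d) / sparsity θ₀ = C₁ / (τ * sparsity θ₀) := by
    rw [hτ]; field_simp
  have hC₁ : 2 * d * τ ≤ C₁ := by
    have : 0 ≤ ∑ j, |θ₀ j| := Finset.sum_nonneg fun j _ => abs_nonneg _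
    linarith
  have hx : 2 * d / sparsity θ₀ ≤ C₁ / (τ * sparsity θ₀) := by
    rw [div_le_div_iff₀ (by positivity) (by positivity)]
    nlinarith
  have hsd : sparsity θ₀ ≤ d := by omega
  obtain ⟨hL, hlogd⟩ := log_two_mul_le hs hsd hx
  have hx2 : 2 ≤ C₁ / (τ * sparsity θ₀) := by
    refine le_trans ?_ hx
    rw [le_div_iff₀ (by positivity)]
    have : (sparsity θ₀ : ℝ) ≤ d := by exact_mod_cast hsd
    linarith
  have hC1' : ∑ j, |θ₀ j| ≤ C₁ := hθ₀.trans (by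
    have : 0 < 2 * d * τ := by positivity
    linarith)
  rw [hxeq]
  have hshift := exp_le_shiftFactor hτ0 θ₀ hs hC1' hx2
  set Λ := sparsity θ₀ * Real.log (C₁ / (τ * sparsity θ₀)) with hΛ
  set m := max 1 (N / d) with hm
  have hm1 : 1 ≤ m := le_max_left _ _
  have hwin := exp_le_window ha hσmax hσ₀ hs1 hs2 hn hm1 hbn hbκ
  rw [← windowConst] at hwin
  have hmis := misfit_le hnd.le hd hN h0 hσ₀ hs1
  rw [← hm] at hmis
  have hq : τ ^ 2 * ∑ i, ∑ j, (z i).2 j ^ 2 ≤ 2 * N ^ 2 / d := by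
    calc τ ^ 2 * ∑ i, ∑ j, (z i).2 j ^ 2 ≤ τ ^ 2 * (2 * n * Cx ^ 2 / η) := by gcongr
      _ = 2 * N ^ 2 / d := by
          rw [hNη, hτ, div_pow, mul_pow, Real.sq_sqrt (by positivity)]
          field_simp
  refine le_trans (ENNReal.ofReal_le_ofReal ?_)
    (le_lintegral_fracRatio_prior hn hd ha hb hτ0 h0 hσ₀ hm1 (by positivity) θ₀ hθ₀ z hq)
  have hW : 0 ≤ windowConst σmin σmax a κ := abs_nonneg _
  have hlog2 := half_lt_log_two
  have hΛ2 : Real.log 2 ≤ Λ := by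
    have h : 1 * Real.log 2 ≤ Λ := by
      rw [hΛ]; exact mul_le_mul hsR hL (by linarith) (by linarith)
    linarith
  have hlogn : Real.log n ≤ 2 * Λ := by
    refine le_trans (Real.log_le_log hnR ?_) hlogd
    have : (n : ℝ) ≤ d := by exact_mod_cast hnd.le
    linarith
  have h4 : Real.exp (-(2 * Real.log 2)) = 1 / 4 := by
    rw [Real.exp_neg, two_mul, Real.exp_add, Real.exp_log (by norm_num)]; norm_num
  have hcoef : 0 ≤ 1 + κ * a := by positivity
  calc _ ≤ Real.exp (-(10 * Λ)) * (Real.exp (-((1 + 8 * σmin) * (α * N)))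
          * Real.exp (-(2 * Real.log 2)))
          * Real.exp (-(windowConst σmin σmax a κ + (1 + κ * a) * Real.log n
            + a * Real.log m)) := by
        rw [← Real.exp_add, ← Real.exp_add, ← Real.exp_add]
        refine Real.exp_le_exp.2 ?_
        have e1 : windowConst σmin σmax a κ * 1 ≤ windowConst σmin σmax a κ * (2 * Λ) :=
          mul_le_mul_of_nonneg_left (by linarith) hW
        have e2 : (1 + κ * a) * Real.log n ≤ (1 + κ * a) * (2 * Λ) :=
          mul_le_mul_of_nonneg_left hlogn hcoef
        linarith
    _ ≤ _ := by
        rw [h4]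
        have := shiftFactor_pos τ θ₀
        gcongr

/-- The exponential moment of a function of `σ` alone under the prior. -/
theorem lintegral_exp_mul_affinity_prior_le (ν : Measure (Fin d → ℝ)) [IsProbabilityMeasure ν]
    {α τ C₁ a b σ₀ : ℝ} (h0 : 0 ≤ α) (h1 : α ≤ 1) (ha : 0 < a) (hb : 0 < b) (θ₀ : Fin d → ℝ)
    (hσ₀ : 0 < σ₀) (f : ℝ → ℝ) (hf : Measurable f) :
    ∫⁻ p, ENNReal.ofReal (Real.exp (f p.2)) * affinity ν α θ₀ σ₀ p ^ n ∂(prior d τ C₁ a b)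
      ≤ ∫⁻ s, ENNReal.ofReal (Real.exp (f s)) ∂((invGammaMeasure a b).map Real.sqrt) := by
  have := isFiniteMeasure_studentPrior d τ C₁
  have := isProbabilityMeasure_invGammaMeasure ha hb
  calc _ ≤ ∫⁻ p, ENNReal.ofReal (Real.exp (f p.2)) ∂(prior d τ C₁ a b) := by
        refine lintegral_mono_ae ((ae_prior d τ C₁ a b ha hb).mono fun p hp => ?_)
        calc _ ≤ ENNReal.ofReal (Real.exp (f p.2)) * 1 ^ n := by
              gcongr
              exact affinity_le_one ν h0 h1 θ₀ p.1 hσ₀ hp.1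
          _ = _ := by simp
    _ = ∫⁻ s, ENNReal.ofReal (Real.exp (f s)) * studentPrior d τ C₁ Set.univ
          ∂((invGammaMeasure a b).map Real.sqrt) := by
        rw [prior, lintegral_prod_symm' _ (by fun_prop)]
        simp
    _ ≤ ∫⁻ s, ENNReal.ofReal (Real.exp (f s)) * 1 ∂((invGammaMeasure a b).map Real.sqrt) := by
        gcongr
        exact normalizeMeasure_univ_le_one _
    _ = _ := by simp

theorem lintegral_exp_negLogAffinity_prior_le_one (ν : Measure (Fin d → ℝ))
    [IsProbabilityMeasure ν] {α τ C₁ a b σ₀ : ℝ} (h0 : 0 ≤ α) (h1 : α ≤ 1) (ha : 0 < a)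
    (hb : 0 < b) (θ₀ : Fin d → ℝ) (hσ₀ : 0 < σ₀) :
    ∫⁻ p, ENNReal.ofReal (Real.exp (n * negLogAffinity ν α θ₀ σ₀ p))
        * affinity ν α θ₀ σ₀ p ^ n ∂(prior d τ C₁ a b) ≤ 1 := by
  have := isFiniteMeasure_studentPrior d τ C₁
  have := isProbabilityMeasure_invGammaMeasure ha hb
  have : IsProbabilityMeasure ((invGammaMeasure a b).map Real.sqrt) :=
    Measure.isProbabilityMeasure_map (by fun_prop)
  calc _ = ∫⁻ _, 1 ∂(prior d τ C₁ a b) := by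
        refine lintegral_congr_ae ((ae_prior d τ C₁ a b ha hb).mono fun p hp => ?_)
        simp only
        rw [show affinity ν α θ₀ σ₀ p = _ from affinity_eq_exp_neg ν h0 h1 θ₀ p.1 hσ₀ hp.1,
          ← ENNReal.ofReal_pow (Real.exp_pos _).le, ← ENNReal.ofReal_mul (Real.exp_pos _).le,
          ← Real.exp_nat_mul, ← Real.exp_add]
        simp
    _ ≤ 1 := by
        rw [lintegral_one, prior, ← Set.univ_prod_univ, Measure.prod_prod,
          measure_univ (μ := (invGammaMeasure a b).map Real.sqrt), mul_one]
        exact normalizeMeasure_univ_le_one _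

theorem rate_target_eq {α ε η N c Cx C₁ : ℝ} {n d s : ℕ} (hn : 0 < n) (hη : 0 < η) (hN : 0 ≤ N)
    (hNη : N ^ 2 = 1 / η) :
    (α + 1) * rate c Cx C₁ n d s + α * √(rate c Cx C₁ n d s / (n * η)) + Real.log (1 / ε) / n
      = ((α + 1) * (c * (s * Real.log (Cx * C₁ * √((n : ℝ) * d) / s)))
        + √(c * (s * Real.log (Cx * C₁ * √((n : ℝ) * d) / s))) * (α * N) + Real.log (1 / ε)) / n := by
  have hnR : (0 : ℝ) < n := by exact_mod_cast hn
  set X := c * (s * Real.log (Cx * C₁ * √((n : ℝ) * d) / s)) with hX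
  have h1 : rate c Cx C₁ n d s = X / n := by rw [rate, hX, mul_assoc]
  have h2 : X / n / (n * η) = X * (N / n) ^ 2 := by
    rw [div_pow, hNη]; field_simp
  rw [h1, h2, Real.sqrt_mul' _ (sq_nonneg _), Real.sqrt_sq (by positivity)]
  ring

/-! ### The two regimes -/

theorem sum_sub_sq_le {C₁ : ℝ} (θ θ₀ : Fin d → ℝ) (h : ∑ j, |θ j| ≤ C₁)
    (h₀ : ∑ j, |θ₀ j| ≤ C₁) : ∑ j, (θ j - θ₀ j) ^ 2 ≤ (2 * C₁) ^ 2 := by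
  calc ∑ j, (θ j - θ₀ j) ^ 2 = ∑ j, |θ j - θ₀ j| ^ 2 := by simp only [sq_abs]
    _ ≤ (∑ j, |θ j - θ₀ j|) ^ 2 := Finset.sum_sq_le_sq_sum_of_nonneg fun j _ => abs_nonneg _
    _ ≤ (2 * C₁) ^ 2 := by
        refine pow_le_pow_left₀ (Finset.sum_nonneg fun j _ => abs_nonneg _) ?_ 2
        calc ∑ j, |θ j - θ₀ j| ≤ ∑ j, (|θ j| + |θ₀ j|) :=
              Finset.sum_le_sum fun j _ => abs_sub _ _
          _ ≤ 2 * C₁ := by rw [Finset.sum_add_distrib]; linarith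

/-- When the variance inflation is paid for by the complexity and `α N`, the target bound follows
from the evidence bound. -/
theorem moderate_regime_budget {A₀ A₁ a K c α N Λ M : ℝ} (h0 : 0 ≤ α) (hN : 0 ≤ N)
    (hΛ : 1 / 2 ≤ Λ) (ha : 0 ≤ a) (hM : M ≤ K * (Λ + α * N))
    (hc1 : A₀ + a * K ≤ c) (hc2 : 2 * (A₁ + a * K) ^ 2 ≤ c) :
    A₀ * Λ + a * M + A₁ * (α * N) ≤ (α + 1) * (c * Λ) + √(c * Λ) * (α * N) := by
  have hc0 : 0 ≤ c := (by positivity : 0 ≤ 2 * (A₁ + a * K) ^ 2).trans hc2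
  have hsqrt : A₁ + a * K ≤ √(c * Λ) := by
    refine Real.le_sqrt_of_sq_le ?_
    nlinarith
  have h1 : a * M ≤ a * (K * (Λ + α * N)) := mul_le_mul_of_nonneg_left hM ha
  have h2 : (A₁ + a * K) * (α * N) ≤ √(c * Λ) * (α * N) :=
    mul_le_mul_of_nonneg_right hsqrt (by positivity)
  have h3 : (A₀ + a * K) * Λ ≤ c * Λ := mul_le_mul_of_nonneg_right hc1 (by linarith)
  have h4 : 0 ≤ α * (c * Λ) := by positivity
  nlinarith

/-- When `log N` dominates the complexity and `α N`, dividing a budget of order `log N` by `log N`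
leaves a constant. -/
theorem dominated_regime_budget {A₀ A₁ a K c y Λ M ℓ u : ℝ} (hA₀ : 0 ≤ A₀) (hA₁ : 0 ≤ A₁)
    (ha : 0 ≤ a) (hK : 2 ≤ K) (hΛ : K * Λ ≤ ℓ) (hy : K * y ≤ ℓ) (hy0 : 0 ≤ K * y) (hM : M ≤ ℓ)
    (hℓ : 1 ≤ ℓ) (hΛ2 : 1 / 2 ≤ Λ) (hc : 2 * (A₀ + a + A₁ + 3 + |u|) ≤ c) :
    u + Real.log 2 + 2 * ℓ + (A₀ * Λ + a * M + A₁ * y) ≤ ℓ * (c * Λ) := by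
  have hK0 : 0 < K := by linarith
  have hy0' : 0 ≤ y := nonneg_of_mul_nonneg_right hy0 hK0
  have hΛℓ : Λ ≤ ℓ := by nlinarith
  have hyℓ : y ≤ ℓ := by nlinarith
  have hlog2' := Real.log_two_lt_d9
  have g1 : A₀ * Λ ≤ A₀ * ℓ := mul_le_mul_of_nonneg_left hΛℓ hA₀
  have g2 : a * M ≤ a * ℓ := mul_le_mul_of_nonneg_left hM ha
  have g3 : A₁ * y ≤ A₁ * ℓ := mul_le_mul_of_nonneg_left hyℓ hA₁
  have g4 : |u| * 1 ≤ |u| * ℓ := mul_le_mul_of_nonneg_left hℓ (abs_nonneg _)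
  have g5 := le_abs_self u
  have hB : 0 ≤ A₀ + a + A₁ + 3 + |u| := by positivity
  have g6 : c * (1 / 2) ≤ c * Λ := mul_le_mul_of_nonneg_left hΛ2 (by linarith)
  have g7 : ℓ * (A₀ + a + A₁ + 3 + |u|) ≤ ℓ * (c * Λ) :=
    mul_le_mul_of_nonneg_left (by linarith) (by linarith)
  linarith

theorem le_exp_of_complexity_le {n d s : ℕ} {X Λ K ℓ : ℝ} (hn : 0 < n) (hnd : n ≤ d) (hs : 1 ≤ s)
    (hsd : s ≤ d) (hX : 0 < X) (hK : 0 < K) (hlogd : Real.log (2 * d) ≤ 2 * Λ)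
    (hXΛ : Real.log X ≤ Λ) (hΛ : K * Λ ≤ ℓ) :
    (n : ℝ) ≤ Real.exp (2 * ℓ / K) ∧ s * X ≤ Real.exp (3 * ℓ / K) := by
  have hn0 : (0 : ℝ) < n := by exact_mod_cast hn
  have hs0 : (0 : ℝ) < s := by exact_mod_cast hs
  have hnd' : (n : ℝ) ≤ d := by exact_mod_cast hnd
  have hsd' : (s : ℝ) ≤ d := by exact_mod_cast hsd
  have hΛK : Λ ≤ ℓ / K := by rw [le_div_iff₀ hK]; linarith
  constructor
  · rw [← Real.log_le_iff_le_exp hn0]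
    calc Real.log n ≤ Real.log (2 * d) := Real.log_le_log hn0 (by linarith)
      _ ≤ 2 * (ℓ / K) := by linarith
      _ = 2 * ℓ / K := by ring
  · rw [← Real.log_le_iff_le_exp (by positivity), Real.log_mul hs0.ne' hX.ne']
    calc Real.log s + Real.log X ≤ Real.log (2 * d) + Λ :=
          add_le_add (Real.log_le_log hs0 (by linarith)) hXΛ
      _ ≤ 3 * (ℓ / K) := by linarith
      _ = 3 * ℓ / K := by ring

/-- When `log N` dominates the complexity and `α N`, the divergence is so small a multiple of
functions of `σ` with exponential moments under the prior that it may be multiplied by `n log N`. -/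
theorem mul_negLogAffinity_le_of_dominated (ν : Measure (Fin d → ℝ)) [IsProbabilityMeasure ν]
    {σmax a κ K α Cx C₁ b ℓ x σ₀ : ℝ} (hσmax : 0 < σmax) (ha : 0 < a) (hκ : 0 ≤ κ)
    (h0 : 0 ≤ α) (h1 : α ≤ 1)
    (hν : ∫⁻ x, ENNReal.ofReal (∑ j, x j ^ 2) ∂ν ≤ ENNReal.ofReal (Cx ^ 2))
    (hK1 : 2 * (8 + 2 * κ) ≤ K) (hK2 : 16 * (4 + (2 * σmax)⁻¹) ≤ K) (hK3 : 8 / a ≤ K)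
    (hσ₀ : 0 < σ₀) (hs : σ₀ ^ 2 ≤ (2 * σmax)⁻¹) (hn : 0 < n) (hbn : (n : ℝ) ^ (-κ) ≤ b)
    (hℓ : 0 ≤ ℓ) (hα : α * Real.exp ℓ ≤ ℓ / K) (hnℓ : (n : ℝ) ≤ Real.exp (2 * ℓ / K))
    (hx1 : 1 ≤ x) (hCx : Cx ^ 2 * C₁ ^ 2 ≤ x ^ 2) (hx : x ≤ Real.exp (3 * ℓ / K))
    (θ₀ θ : Fin d → ℝ) {σ : ℝ} (hσ : 0 < σ) (hθ : ∑ j, |θ j| ≤ C₁) (hθ₀ : ∑ j, |θ₀ j| ≤ C₁) :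
    ℓ * n * negLogAffinity ν α θ₀ σ₀ (θ, σ)
      ≤ a * max 0 (Real.log (σ / σ₀)) + b / (2 * σ ^ 2) := by
  have hK0 : 0 < K := by linarith
  have hnR : (1 : ℝ) ≤ n := by exact_mod_cast hn
  have hn0 : (0 : ℝ) < n := by linarith
  have hnκ1 : 1 ≤ (n : ℝ) ^ κ := Real.one_le_rpow hnR hκ
  have hnκ0 : 0 < (n : ℝ) ^ κ := by linarith
  have hx0 : 0 ≤ x := by linarith
  have hD : 0 < (2 * σmax)⁻¹ := by positivity
  set V := σ₀ ^ 2 + Cx ^ 2 * (2 * C₁) ^ 2 with hV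
  have hVx : V ≤ (4 + (2 * σmax)⁻¹) * x ^ 2 := by
    have hx2 : 1 ≤ x ^ 2 := one_le_pow₀ hx1
    have : (2 * σmax)⁻¹ * 1 ≤ (2 * σmax)⁻¹ * x ^ 2 := mul_le_mul_of_nonneg_left hx2 hD.le
    rw [hV]
    nlinarith
  have e1 := small_fraction (V := V) hK1 hK0 hκ hℓ h0 hα hn hnℓ (by positivity) hVx hx0 hx
  have e2 := small_fraction (V := 1) (D := 1) hK1 hK0 hκ hℓ h0 hα hn hnℓ zero_le_one
    (by rw [one_mul]; exact one_le_pow₀ hx1) hx0 hx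
  have f1 : ℓ * n * α * V ≤ b / 2 := by
    have h8 : 8 * (4 + (2 * σmax)⁻¹) / K ≤ 1 / 2 := by
      rw [div_le_iff₀ hK0]; linarith
    have hb' : (n : ℝ) ^ (-κ) / 2 ≤ b / 2 := by linarith
    refine le_trans ?_ hb'
    rw [Real.rpow_neg hn0.le, le_div_iff₀ (by norm_num), ← one_div, le_div_iff₀ hnκ0]
    linarith
  have f2 : ℓ * n * α ≤ a := by
    have h8 : 8 * 1 / K ≤ a := by
      rw [div_le_iff₀ hK0]; rw [div_le_iff₀ ha] at hK3; linarith
    have hpos : 0 ≤ ℓ * n * α := by positivity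
    nlinarith
  have hR := sum_sub_sq_le θ θ₀ hθ hθ₀
  have hD' := negLogAffinity_le ν h0 h1 hν θ₀ θ hσ₀ hσ hR
  rw [← hV] at hD'
  have hm0 : 0 ≤ max 0 (Real.log (σ / σ₀)) := le_max_left _ _
  calc ℓ * n * negLogAffinity ν α θ₀ σ₀ (θ, σ)
      ≤ ℓ * n * (α * (max 0 (Real.log (σ / σ₀)) + V / σ ^ 2)) := by gcongr
    _ = ℓ * n * α * max 0 (Real.log (σ / σ₀)) + ℓ * n * α * V / σ ^ 2 := by ring
    _ ≤ a * max 0 (Real.log (σ / σ₀)) + b / 2 / σ ^ 2 := by gcongr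
    _ = _ := by rw [div_div]

end

set_option maxHeartbeats 1000000 in
theorem mainTheorem1 (σmin σmax a κ : ℝ) (hσmin : 0 < σmin) (hσmax : 0 < σmax)
    (ha : 0 < a) :
    ∃ c : ℝ, 0 < c ∧
      ∀ (α ε η : ℝ), α ∈ Set.Ioo (0 : ℝ) 1 → ε ∈ Set.Ioo (0 : ℝ) 1 → η ∈ Set.Ioo (0 : ℝ) 1 →
      ∀ (n d : ℕ) (ν : Measure (Fin d → ℝ)) (Cx C₁ b τ : ℝ) (θ₀ : Fin d → ℝ) (σ₀ : ℝ),
        IsProbabilityMeasure ν →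
        0 < Cx →
        ∫⁻ x, ENNReal.ofReal (∑ j, x j ^ 2) ∂ν < ENNReal.ofReal (Cx ^ 2) →
        0 < σ₀ → (2 * σmin)⁻¹ < σ₀ ^ 2 → σ₀ ^ 2 < (2 * σmax)⁻¹ →
        (n : ℝ) ^ (-κ) ≤ b → b ≤ κ →
        τ = 1 / (Cx * √((n : ℝ) * d)) →
        1 ≤ sparsity θ₀ → sparsity θ₀ < n → n < d →
        ∑ j, |θ₀ j| ≤ C₁ - 2 * d * τ →
        ENNReal.ofReal (1 - ε - η) ≤
          (Measure.pi fun _ : Fin n => modelLaw ν θ₀ σ₀)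
            {z | ∫⁻ p, (renyiDiv α (modelLaw ν p.1 p.2) (modelLaw ν θ₀ σ₀)).toENNReal
                    ∂(fractionalPosterior α (prior d τ C₁ a b) z) ≤
                  ENNReal.ofReal
                    (((α + 1) * rate c Cx C₁ n d (sparsity θ₀)
                      + α * √(rate c Cx C₁ n d (sparsity θ₀) / (n * η))
                      + Real.log (1 / ε) / n) / (1 - α))} := by
  set A₀ := 12 + 2 * windowConst σmin σmax a κ + 2 * (1 + κ * a) with hA₀
  set A₁ := 1 + 8 * σmin with hA₁
  set K := 2 * (8 + 2 * κ) + 16 * (4 + (2 * σmax)⁻¹) + 8 / a with hK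
  set U := 2 ^ a + Real.Gamma (a / 2) / Real.Gamma a * (4 * κ * σmin) ^ (a / 2) with hU
  set c := 1 + |A₀ + a * K| + 2 * (A₁ + a * K) ^ 2 + 2 * |A₀ + a + A₁ + 3 + (|Real.log U|)| with hc
  -- `K` separates the two regimes and is chosen for the one dominated by `log N`. If `κ ≤ 0` the
  -- hypotheses on `b` cannot hold; the absolute values make `c` positive in that case as well.
  refine ⟨c, by positivity, ?_⟩
  rintro α ε η ⟨hα0, hα1⟩ ⟨hε0, hε1⟩ ⟨hη0, hη1⟩ n d ν Cx C₁ b τ θ₀ σ₀ hprob hCx hν hσ₀ hlow hupp hbn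
    hbκ hτ hs hsn hnd hθ₀
  have hc1 : A₀ + a * K ≤ c := by
    have := le_abs_self (A₀ + a * K)
    have : 0 ≤ 2 * (A₁ + a * K) ^ 2 := by positivity
    have := abs_nonneg (A₀ + a + A₁ + 3 + |Real.log U|)
    linarith
  have hc2 : 2 * (A₁ + a * K) ^ 2 ≤ c := by
    have := abs_nonneg (A₀ + a * K)
    have := abs_nonneg (A₀ + a + A₁ + 3 + |Real.log U|)
    linarith
  have hc3 : 2 * (A₀ + a + A₁ + 3 + |Real.log U|) ≤ c := by
    have := abs_nonneg (A₀ + a * K)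
    have : 0 ≤ 2 * (A₁ + a * K) ^ 2 := by positivity
    have := le_abs_self (A₀ + a + A₁ + 3 + |Real.log U|)
    linarith
  have hn : 0 < n := by omega
  have hd : 0 < d := by omega
  have hnR : (1 : ℝ) ≤ n := by exact_mod_cast hn
  have hdR : (1 : ℝ) ≤ d := by exact_mod_cast hd
  have hsR : (1 : ℝ) ≤ sparsity θ₀ := by exact_mod_cast hs
  have hb : 0 < b := lt_of_lt_of_le (Real.rpow_pos_of_pos (by linarith) _) hbn
  have hκ : 0 < κ := lt_of_lt_of_le hb hbκ
  have hs1 : (σ₀ ^ 2)⁻¹ ≤ 2 * σmin := by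
    rw [inv_le_comm₀ (by positivity) (by positivity)]; exact hlow.le
  have hs2 : 2 * σmax ≤ (σ₀ ^ 2)⁻¹ := by
    rw [le_inv_comm₀ (by positivity) (by positivity)]; exact hupp.le
  have hτ0 : 0 < τ := by rw [hτ]; positivity
  have hdτ : 0 < 2 * d * τ := by positivity
  have hθ₀' : ∑ j, |θ₀ j| ≤ C₁ := by linarith
  have hC₁ : 2 * d * τ ≤ C₁ := by
    have : 0 ≤ ∑ j, |θ₀ j| := Finset.sum_nonneg fun j _ => abs_nonneg _
    linarith
  have hα1' : 0 < 1 - α := by linarith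
  have hW : 0 ≤ windowConst σmin σmax a κ := abs_nonneg _
  have hA₀0 : 0 ≤ A₀ := by positivity
  have hA₁0 : 0 ≤ A₁ := by positivity
  have h8a : 0 < 8 / a := by positivity
  have hσinv : 0 < (2 * σmax)⁻¹ := by positivity
  have hK1 : 2 * (8 + 2 * κ) ≤ K := by linarith
  have hK2 : 16 * (4 + (2 * σmax)⁻¹) ≤ K := by linarith
  have hK3 : 8 / a ≤ K := by linarith
  have hKge : 2 ≤ K := by linarith
  have hK0 : 0 < K := by linarith
  -- `N` is `η^(-1/2)`, the scale on which the square-root term of the bound lives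
  obtain ⟨N, hN, hNη⟩ : ∃ N : ℝ, 1 ≤ N ∧ N ^ 2 = 1 / η := by
    refine ⟨√(1 / η), ?_, Real.sq_sqrt (by positivity)⟩
    rw [Real.one_le_sqrt, le_div_iff₀ hη0]
    linarith
  have hN0 : 0 < N := by linarith
  set X := Cx * C₁ * √((n : ℝ) * d) / sparsity θ₀ with hX
  have hXge : 2 * d / sparsity θ₀ ≤ X := by
    have h : Cx * √((n : ℝ) * d) = 1 / τ := by rw [hτ]; field_simp
    rw [hX, mul_right_comm, h]
    refine div_le_div_of_nonneg_right ?_ (by linarith)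
    rw [one_div_mul_eq_div, le_div_iff₀ hτ0]
    exact hC₁
  have hsd : sparsity θ₀ ≤ d := by omega
  obtain ⟨hL, hlogd⟩ := log_two_mul_le hs hsd hXge
  set Λ := sparsity θ₀ * Real.log X with hΛ
  have hlog2 := half_lt_log_two
  have hLΛ : Real.log X ≤ Λ := by
    have : 1 * Real.log X ≤ Λ := mul_le_mul_of_nonneg_right hsR (by linarith)
    linarith
  have hΛ2 : 1 / 2 ≤ Λ := by linarith
  set M := Real.log (max 1 (N / d)) with hM
  have hM0 : 0 ≤ M := Real.log_nonneg (le_max_left _ _)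
  have hev : ∀ z : Fin n → ℝ × (Fin d → ℝ), ∑ i, ∑ j, (z i).2 j ^ 2 ≤ 2 * n * Cx ^ 2 / η →
      ENNReal.ofReal (Real.exp (-(A₀ * Λ + a * M + A₁ * (α * N))))
        ≤ ∫⁻ p, fracRatio α θ₀ σ₀ z p ∂(prior d τ C₁ a b) :=
    fun z hz => exp_le_lintegral_fracRatio_prior hσmax ha hα0.le hCx hη0 hN hNη hσ₀ hs1 hs2 hbn hbκ
      hτ hn hnd θ₀ hs hsn hθ₀ z hz
  have hfin := isFiniteMeasure_studentPrior d τ C₁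
  have hig := isProbabilityMeasure_invGammaMeasure ha hb
  have hsf : SFinite (prior d τ C₁ a b) := by unfold prior; infer_instance
  have hae := ae_prior d τ C₁ a b ha hb
  have hpos : ∀ᵐ p ∂(prior d τ C₁ a b), 0 < p.2 := hae.mono fun p hp => hp.1
  have hmA := measurable_negLogAffinity ν α θ₀ σ₀
  have htarget := rate_target_eq (α := α) (ε := ε) (c := c) (Cx := Cx) (C₁ := C₁) (d := d)
    (s := sparsity θ₀) hn hη0 hN0.le hNη
  rw [← hX, ← hΛ] at htarget
  rw [htarget]
  have hlogε : 0 ≤ Real.log (1 / ε) := Real.log_nonneg (by rw [le_div_iff₀ hε0]; linarith)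
  by_cases hcase : M ≤ K * (Λ + α * N)
  · -- the function `F = n (1 - α) D_α` has exponential moment at most one against the affinity
    have hbudget := moderate_regime_budget hα0.le hN0.le hΛ2 ha.le hcase hc1 hc2
    have hmain := le_measure_lintegral_renyiDiv_le ν hα0.le hα1 hn hCx hη0 hν.le
      (prior d τ C₁ a b) hpos θ₀ hσ₀ (fun p => n * negLogAffinity ν α θ₀ σ₀ p) (by fun_prop)
      (l := n) (U := 1) (δ := ε) (by linarith) one_pos hε0 (ae_of_all _ fun p => le_rfl)
      (by simpa using lintegral_exp_negLogAffinity_prior_le_one ν hα0.le hα1.le ha hb θ₀ hσ₀)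
      hev
    refine le_trans (ENNReal.ofReal_le_ofReal (by linarith)) (hmain.trans (measure_mono ?_))
    intro z hz
    refine le_trans (Set.mem_ofPred_eq ▸ hz) (ENNReal.ofReal_le_ofReal ?_)
    rw [← div_div]
    refine div_le_div_of_nonneg_right (div_le_div_of_nonneg_right ?_ (by linarith)) hα1'.le
    linarith
  · -- here `log N` is at least `K` times the complexity, and `F` depends on `σ` only; the probability
    -- `ε` is not needed, and `η` is shared between the design and the exponential moment
    have hcase' : K * (Λ + α * N) < M := not_le.1 hcase
    set ℓ := Real.log N with hℓ
    have hMℓ : M ≤ ℓ := by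
      refine Real.log_le_log (by positivity) (max_le hN ?_)
      exact div_le_self hN0.le hdR
    rw [mul_add] at hcase'
    have hKαN0 : 0 ≤ K * (α * N) := by positivity
    have hKΛ0 : K * (1 / 2) ≤ K * Λ := mul_le_mul_of_nonneg_left hΛ2 hK0.le
    have hKΛ : K * Λ ≤ ℓ := by linarith
    have hKαN : K * (α * N) ≤ ℓ := by linarith
    have hℓ1 : 1 ≤ ℓ := by linarith
    have hexpℓ : Real.exp ℓ = N := Real.exp_log hN0
    have hαK : α * Real.exp ℓ ≤ ℓ / K := by rw [hexpℓ, le_div_iff₀ hK0]; linarith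
    have hX2 : 2 ≤ X := by
      refine le_trans ?_ hXge
      rw [le_div_iff₀ (by linarith)]
      have : (sparsity θ₀ : ℝ) ≤ d := by exact_mod_cast hsd
      linarith
    have hsX : sparsity θ₀ * X = Cx * C₁ * √((n : ℝ) * d) := by
      rw [hX]; field_simp
    have hx1 : 1 ≤ sparsity θ₀ * X := by
      have : 1 * 2 ≤ sparsity θ₀ * X := mul_le_mul hsR hX2 (by norm_num) (by linarith)
      linarith
    obtain ⟨hnℓ, hxℓ⟩ := le_exp_of_complexity_le hn hnd.le hs hsd (by linarith) hK0 hlogd hLΛ hKΛ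
    have hCC : Cx ^ 2 * C₁ ^ 2 ≤ (sparsity θ₀ * X) ^ 2 := by
      rw [hsX, mul_pow, mul_pow, Real.sq_sqrt (by positivity)]
      have : (1 : ℝ) ≤ n * d := one_le_mul_of_one_le_of_one_le hnR hdR
      exact le_mul_of_one_le_right (by positivity) this
    have hUb : ∫⁻ p, ENNReal.ofReal (Real.exp (a * max 0 (Real.log (p.2 / σ₀)) + b / (2 * p.2 ^ 2)))
        * affinity ν α θ₀ σ₀ p ^ n ∂(prior d τ C₁ a b) ≤ ENNReal.ofReal U := by
      refine (lintegral_exp_mul_affinity_prior_le ν hα0.le hα1.le ha hb θ₀ hσ₀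
        (fun s => a * max 0 (Real.log (s / σ₀)) + b / (2 * s ^ 2)) (by fun_prop)).trans ?_
      refine (lintegral_exp_map_sqrt_invGammaMeasure_le ha hb hσ₀).trans
        (ENNReal.ofReal_le_ofReal ?_)
      have hG := Real.Gamma_pos_of_pos ha
      have hG2 := Real.Gamma_pos_of_pos (half_pos ha)
      have h4 : 2 * b / σ₀ ^ 2 ≤ 4 * κ * σmin := by
        calc 2 * b / σ₀ ^ 2 = 2 * b * (σ₀ ^ 2)⁻¹ := div_eq_mul_inv _ _
          _ ≤ 2 * κ * (2 * σmin) := by gcongr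
          _ = 4 * κ * σmin := by ring
      rw [hU]
      gcongr
    have hU0 : 0 < U := by
      have h1 : (0 : ℝ) < 2 ^ a := Real.rpow_pos_of_pos (by norm_num) _
      have hG := Real.Gamma_pos_of_pos ha
      have hG2 := Real.Gamma_pos_of_pos (half_pos ha)
      positivity
    have hmain := le_measure_lintegral_renyiDiv_le ν hα0.le hα1 hn hCx hη0 hν.le
      (prior d τ C₁ a b) hpos θ₀ hσ₀
      (fun p => a * max 0 (Real.log (p.2 / σ₀)) + b / (2 * p.2 ^ 2)) (by fun_prop)
      (l := ℓ * n) (U := U) (δ := η / 2) (by positivity) hU0 (by positivity)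
      (hae.mono fun p hp => mul_negLogAffinity_le_of_dominated ν hσmax ha hκ.le hα0.le hα1.le hν.le
        hK1 hK2 hK3 hσ₀ hupp.le hn hbn (by linarith) hαK hnℓ hx1 hCC hxℓ θ₀ p.1 hp.1 hp.2 hθ₀')
      hUb hev
    refine le_trans (ENNReal.ofReal_le_ofReal (by linarith)) (hmain.trans (measure_mono ?_))
    intro z hz
    refine le_trans (Set.mem_ofPred_eq ▸ hz) (ENNReal.ofReal_le_ofReal ?_)
    have hℓ0 : 0 < ℓ := by linarith
    have hn0 : (0 : ℝ) < n := by linarith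
    have hlogη : Real.log (U / (η / 2)) = Real.log U + Real.log 2 + 2 * ℓ := by
      have : U / (η / 2) = U * 2 * (1 / η) := by field_simp
      rw [this, ← hNη, Real.log_mul (by positivity) (by positivity),
        Real.log_mul (by positivity) (by norm_num), Real.log_pow, ← hℓ]
      norm_num
    have hbud : Real.log (U / (η / 2)) + (A₀ * Λ + a * M + A₁ * (α * N)) ≤ ℓ * (c * Λ) := by
      rw [hlogη]
      exact dominated_regime_budget hA₀0 hA₁0 ha.le hKge hKΛ hKαN hKαN0 hMℓ hℓ1 hΛ2 hc3
    have hc0 : 0 ≤ c := by positivity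
    have hΛ0 : 0 ≤ Λ := by linarith
    have hfinal : c * Λ ≤ (α + 1) * (c * Λ) + √(c * Λ) * (α * N) + Real.log (1 / ε) := by
      have : 0 ≤ α * (c * Λ) := by positivity
      have : 0 ≤ √(c * Λ) * (α * N) := by positivity
      linarith
    rw [← div_div]
    refine div_le_div_of_nonneg_right ?_ hα1'.le
    rw [← div_div]
    refine div_le_div_of_nonneg_right ?_ hn0.le
    rw [div_le_iff₀ hℓ0]
    calc _ ≤ ℓ * (c * Λ) := hbud
      _ ≤ ℓ * ((α + 1) * (c * Λ) + √(c * Λ) * (α * N) + Real.log (1 / ε)) := by gcongr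
      _ = _ := mul_comm _ _
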